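/- **Setting.** Let $L$ be a finitary signature. An abstract elementary class (AEC) $\mathcal K$ is a class of $L$-structures with a strong submodel relation $\prec_{\mathcal K}$, both closed under isomorphism, such that: $\prec_{\mathcal K}$ is a partial order on $\mathcal K$ refining the substructure relation; for a nonempty continuous $\prec_{\mathcal K}$-increasing chain in $\mathcal K$, the union is in $\mathcal K$, every member of the chain is a strong submodel of the union, and the union is a strong submodel of every $M$ of which all the members are strong submodels; if $M_0,M_1\prec_{\mathcal K}M$ and $M_0\subseteq M_1$, then $M_0\prec_{\mathcal K}M_1$; and there is an infinite cardinal $\kappa$ such that every subset $A$ of every $M\in\mathcal K$ is contained in some $M_0\prec_{\mathcal K}M$ with $|M_0|\le|A|+\kappa$. The least such $\kappa$ is $\mathrm{LS}(\mathcal K)$. A strong embedding is an isomorphism onto a strong submodel. $|L(\mathcal K)|$ is the number of symbols of $L$. Let $\mathcal K$ have the joint embedding and the amalgamation properties (for strong embeddings). The set $\text{ga-S}(M)$ of Galois types over $M\in\mathcal K$ consists of the classes of pairs $(N,a)$ with $M\prec_{\mathcal K}N$ and $a\in N$, where $(N_1,a_1)$ and $(N_2,a_2)$ are equivalent if there are strong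 embeddings $g_i:N_i\to P$ into a common $P\in\mathcal K$ which agree on $M$ and satisfy $g_1(a_1)=g_2(a_2)$ (inside a monster model: the orbits of elements under the automorphisms fixing $M$ pointwise). For $N\prec_{\mathcal K}M$, $q\upharpoonright N$ is the type over $N$ of a realization of $q$, and $\mathrm{Sub}_{\le\lambda}(M)=\{N\prec_{\mathcal K}M:|N|\le\lambda\}$. The class $\mathcal K$ is $\chi$-*tame* if for all $M\in\mathcal K$ and distinct $p,p'\in\text{ga-S}(M)$ there is $N\in\mathrm{Sub}_{\le\chi}(M)$ with $p\upharpoonright N\ne p'\upharpoonright N$. It is *stable in* $\lambda$ ($\lambda$-stable) if $|\text{ga-S}(M)|=\lambda$ for every $M\in\mathcal K$ with $|M|=\lambda$. For $q\in\text{ga-S}(M)$ with $|M|\le\nu$ put $\mathrm{RM}^\nu[q]\ge0$ always; $\mathrm{RM}^\nu[q]\ge\alpha$ for limit $\alpha$ if $\mathrm{RM}^\nu[q]\ge\beta$ for all $\beta<\alpha$; and $\mathrm{RM}^\nu[q]\ge\alpha+1$ if for some $M'\succ_{\mathcal K}M$ there are more than $\nu$ types $q'\in\text{ga-S}(M')$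 extending $q$ with $\mathrm{RM}^\nu[q'\upharpoonright N]\ge\alpha$ for all $N\in\mathrm{Sub}_{\le\nu}(M')$. For $M$ of any size, $\mathrm{RM}^\nu[q]=\min\{\mathrm{RM}^\nu[q\upharpoonright N]:N\in\mathrm{Sub}_{\le\nu}(M)\}$. $\mathcal K$ is $\nu$-*totally transcendental* if $\mathrm{RM}^\nu[q]$ is an ordinal for all $M\in\mathcal K$ and $q\in\text{ga-S}(M)$. **Proposition 5.3.** Suppose that $\mathcal K$ is $\chi$-tame for some $\chi\ge\mathrm{LS}(\mathcal K)$, and $\lambda$-stable for some $\lambda\ge\chi+|L(\mathcal K)|$ with $\lambda^{\aleph_0}>\lambda$. Then $\mathcal K$ is stable in every infinite cardinal $\mu$ with $\mu^\lambda=\mu$. Moreover, there is a least cardinal $\kappa\ge\chi+|L(\mathcal K)|$ at which $\mathcal K$ is totally transcendental, $\kappa\le\lambda$, and $\mathcal K$ is stable in every infinite cardinal $\mu$ with $\mu^\kappa=\mu$. -/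

import Mathlib

open Cardinal FirstOrder FirstOrder.Language

universe u v w

/-- A class of `L`-structures (with underlying sets in `Type w`) together with a relation
`S ≺ N` ("`S` is a strong submodel of `N`") between `L`-substructures `S` of a structure `N`
and the structure `N`. -/
structure StrongClass (L : FirstOrder.Language.{u, v}) where
  /-- `M` belongs to the class. -/
  Mem : ∀ (M : Type w) [L.Structure M], Prop
  /-- `S ≺ N`. -/
  Strong : ∀ (N : Type w) [L.Structure N], L.Substructure N → Prop

namespace StrongClass

variable {L : FirstOrder.Language.{u, v}} (K : StrongClass.{u, v, w} L)

/-- `S ≺ T` for two substructures `S`, `T` of one and the same structure `M`. -/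
def StrongLE {M : Type w} [L.Structure M] (S T : L.Substructure M) : Prop :=
  S ≤ T ∧ K.Strong T (S.comap T.subtype.toHom)

/-- `(S α | α < δ)` is a continuous `≺`-increasing sequence of members of the class (all of them
substructures of a structure `M`, which need not belong to the class). Only the values `S α` with
`α < δ` matter. -/
structure IsChain {M : Type w} [L.Structure M] (δ : Ordinal.{w})
    (S : Ordinal.{w} → L.Substructure M) : Prop where
  mem : ∀ α, α < δ → K.Mem (S α)
  increasing : ∀ α β, α < β → β < δ → K.StrongLE (S α) (S β)
  continuous : ∀ α, α < δ → Order.IsSuccLimit α →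
    (S α : Set M) = ⋃ β : Set.Iio α, (S β.1 : Set M)

/-- `κ` is an infinite cardinal that witnesses the downward Löwenheim-Skolem property. -/
def IsLSBound (κ : Cardinal.{w}) : Prop :=
  ℵ₀ ≤ κ ∧ ∀ (M : Type w) [L.Structure M], K.Mem M → ∀ A : Set M,
    ∃ S : L.Substructure M, K.Strong M S ∧ A ⊆ S ∧ #S ≤ #A + κ

/-- The axioms of abstract elementary classes. That a strong submodel is a substructure
(and hence that `≺` is antisymmetric) is built into the type of `Strong`. -/
structure IsAEC : Prop where
  /-- `≺` relates members of the class only. -/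
  mem_left : ∀ (N : Type w) [L.Structure N] (S : L.Substructure N), K.Strong N S → K.Mem S
  mem_right : ∀ (N : Type w) [L.Structure N] (S : L.Substructure N), K.Strong N S → K.Mem N
  /-- The class is closed under isomorphism. -/
  mem_equiv : ∀ (M N : Type w) [L.Structure M] [L.Structure N], (M ≃[L] N) → K.Mem M → K.Mem N
  /-- `≺` is closed under isomorphism. -/
  strong_equiv : ∀ (M N : Type w) [L.Structure M] [L.Structure N] (e : M ≃[L] N)
    (S : L.Substructure M), K.Strong M S → K.Strong N (S.map e.toHom)
  /-- `≺` is reflexive on the class. -/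
  strong_top : ∀ (M : Type w) [L.Structure M], K.Mem M → K.Strong M ⊤
  /-- `≺` is transitive. -/
  strong_trans : ∀ (N : Type w) [L.Structure N] (S T : L.Substructure N),
    K.StrongLE S T → K.Strong N T → K.Strong N S
  /-- Unions of chains. -/
  union_mem : ∀ (M : Type w) [L.Structure M] (δ : Ordinal.{w}) (S : Ordinal.{w} → L.Substructure M)
    (T : L.Substructure M), 0 < δ → K.IsChain δ S →
    (T : Set M) = ⋃ α : Set.Iio δ, (S α.1 : Set M) → K.Mem T
  strong_union : ∀ (M : Type w) [L.Structure M] (δ : Ordinal.{w})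
    (S : Ordinal.{w} → L.Substructure M) (T : L.Substructure M), 0 < δ → K.IsChain δ S →
    (T : Set M) = ⋃ α : Set.Iio δ, (S α.1 : Set M) → ∀ α, α < δ → K.StrongLE (S α) T
  union_strong : ∀ (M : Type w) [L.Structure M] (δ : Ordinal.{w})
    (S : Ordinal.{w} → L.Substructure M) (T : L.Substructure M), 0 < δ → K.IsChain δ S →
    (T : Set M) = ⋃ α : Set.Iio δ, (S α.1 : Set M) → (∀ α, α < δ → K.Strong M (S α)) →
    K.Strong M T
  /-- Coherence. -/
  coherence : ∀ (M : Type w) [L.Structure M] (S T : L.Substructure M),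
    K.Strong M S → K.Strong M T → S ≤ T → K.StrongLE S T
  /-- Downward Löwenheim-Skolem. -/
  exists_isLSBound : ∃ κ : Cardinal.{w}, K.IsLSBound κ

end StrongClass

/-- Abstract elementary classes of `L`-structures. -/
structure AEC (L : FirstOrder.Language.{u, v}) extends StrongClass.{u, v, w} L where
  isAEC : toStrongClass.IsAEC

namespace AEC

variable {L : FirstOrder.Language.{u, v}} (K : AEC.{u, v, w} L)

/-- The Löwenheim-Skolem number `LS(K)`. -/
noncomputable def LS : Cardinal.{w} := sInf {κ | K.IsLSBound κ}

/-- `f : M → N` is a strong embedding: it is an isomorphism onto a strong submodel of `N`. -/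
def IsStrongEmb {M N : Type w} [L.Structure M] [L.Structure N] (f : M ↪[L] N) : Prop :=
  K.Strong N f.toHom.range

variable {K} in
theorem IsStrongEmb.comp {M N P : Type w} [L.Structure M] [L.Structure N] [L.Structure P]
    {g : N ↪[L] P} {f : M ↪[L] N} (hg : K.IsStrongEmb g) (hf : K.IsStrongEmb f) :
    K.IsStrongEmb (g.comp f) := by
  have h1 := K.isAEC.strong_equiv _ _ g.equivRange _ hf
  refine K.isAEC.strong_trans P _ g.toHom.range ⟨?_, ?_⟩ hg
  · rintro _ ⟨x, rfl⟩
    exact ⟨f x, rfl⟩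
  · convert h1 using 1
    ext ⟨y, hy⟩
    simp only [Substructure.mem_comap, Hom.mem_range, Substructure.mem_map]
    constructor
    · rintro ⟨x, hx⟩
      exact ⟨f x, ⟨x, rfl⟩, Subtype.ext hx⟩
    · rintro ⟨_, ⟨x, rfl⟩, hx⟩
      exact ⟨x, congrArg Subtype.val hx⟩

variable {K} in
theorem isStrongEmb_subtype {M : Type w} [L.Structure M] {S : L.Substructure M}
    (hS : K.Strong M S) : K.IsStrongEmb S.subtype := by
  have h : S.subtype.toHom.range = S := by
    ext x
    constructor
    · rintro ⟨y, rfl⟩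
      exact y.2
    · intro hx
      exact ⟨⟨x, hx⟩, rfl⟩
  unfold IsStrongEmb
  rwa [h]

/-- The joint embedding property. -/
def JointEmbedding : Prop :=
  ∀ (M₁ M₂ : Type w) [L.Structure M₁] [L.Structure M₂], K.Mem M₁ → K.Mem M₂ →
    ∃ (N : Type w) (_ : L.Structure N) (f₁ : M₁ ↪[L] N) (f₂ : M₂ ↪[L] N),
      K.IsStrongEmb f₁ ∧ K.IsStrongEmb f₂

/-- The amalgamation property. -/
def Amalgamation : Prop :=
  ∀ (M₀ M₁ M₂ : Type w) [L.Structure M₀] [L.Structure M₁] [L.Structure M₂]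
    (f₁ : M₀ ↪[L] M₁) (f₂ : M₀ ↪[L] M₂), K.IsStrongEmb f₁ → K.IsStrongEmb f₂ →
    ∃ (N : Type w) (_ : L.Structure N) (g₁ : M₁ ↪[L] N) (g₂ : M₂ ↪[L] N),
      K.IsStrongEmb g₁ ∧ K.IsStrongEmb g₂ ∧ g₁.comp f₁ = g₂.comp f₂

/-- An element `a` of a strong extension `N` of `M`. -/
structure Pointed (M : Type w) [L.Structure M] where
  N : Type w
  [str : L.Structure N]
  emb : M ↪[L] N
  strong : K.IsStrongEmb emb
  a : N

attribute [instance] Pointed.str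

variable {K} in
/-- The elements `p.a` and `q.a` of two strong extensions of `M` are identified by strong embeddings
of these extensions, over `M`, into a common strong extension. -/
def Pointed.Rel {M : Type w} [L.Structure M] (p q : K.Pointed M) : Prop :=
  ∃ (P : Type w) (_ : L.Structure P) (g : p.N ↪[L] P) (h : q.N ↪[L] P),
    K.IsStrongEmb g ∧ K.IsStrongEmb h ∧ g.comp p.emb = h.comp q.emb ∧ g p.a = h q.a

/-- The set `ga-S(M)` of Galois types (of single elements) over `M`: the quotient of the elements of
strong extensions of `M` by the equivalence relation that `Pointed.Rel` generates. Under
amalgamation `Pointed.Rel` is itself an equivalence relation; inside a monster model, two elements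
are equivalent iff they lie in the same orbit of the automorphisms that fix `M` pointwise. -/
def GaType (M : Type w) [L.Structure M] : Type max u v (w + 1) :=
  Quot (Pointed.Rel (K := K) (M := M))

variable {K} in
/-- The restriction of a Galois type over `M` along a strong embedding `f : M₀ → M`. -/
def GaType.restrict {M₀ M : Type w} [L.Structure M₀] [L.Structure M] (f : M₀ ↪[L] M)
    (hf : K.IsStrongEmb f) : K.GaType M → K.GaType M₀ :=
  Quot.map (fun p => ⟨p.N, p.emb.comp f, p.strong.comp hf, p.a⟩) (by
    rintro p q ⟨P, _, g, h, hg, hh, hc, ha⟩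
    refine ⟨P, inferInstance, g, h, hg, hh, ?_, ha⟩
    ext x
    exact DFunLike.congr_fun hc (f x))

variable {K} in
/-- The restriction `q ↾ S` of a Galois type over `M` to a strong submodel `S` of `M`. -/
def GaType.restrictTo {M : Type w} [L.Structure M] (S : L.Substructure M) (hS : K.Strong M S)
    (q : K.GaType M) : K.GaType S :=
  q.restrict S.subtype (isStrongEmb_subtype hS)

/-- `K` is `χ`-tame. -/
def Tame (χ : Cardinal.{w}) : Prop :=
  ∀ (M : Type w) [L.Structure M], K.Mem M → ∀ p q : K.GaType M, p ≠ q →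
    ∃ (S : L.Substructure M) (hS : K.Strong M S), #S ≤ χ ∧ p.restrictTo S hS ≠ q.restrictTo S hS

/-- `K` is `lam`-Galois stable: there are exactly `lam` Galois types over each model of
cardinality `lam`. -/
def Stable (lam : Cardinal.{w}) : Prop :=
  ∀ (M : Type w) [L.Structure M], K.Mem M → #M = lam →
    #(K.GaType M) = Cardinal.lift.{max u v (w + 1)} lam

/-- `K.SmallRankGE lam α M q` is the statement `RM^lam[q] ≥ α` for a Galois type `q` over a model
`M` of cardinality at most `lam`, by recursion on `α`: it always holds for `α = 0`;
it holds for `α + 1` if over some strong extension `M'` of `M` there are more than `lam` extensions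
`q'` of `q` such that `RM^lam[q' ↾ N] ≥ α` for all strong submodels `N` of `M'` with `|N| ≤ lam`;
it holds for a limit `α` if it holds for all `β < α`. -/
noncomputable def SmallRankGE (lam : Cardinal.{w}) (α : Ordinal.{max u v (w + 1)}) :
    ∀ (M : Type w) [L.Structure M], K.GaType M → Prop :=
  Ordinal.limitRecOn (motive := fun _ => ∀ (M : Type w) [L.Structure M], K.GaType M → Prop) α
    (fun _ _ _ => True)
    (fun _ ih M _ q =>
      ∃ (M' : Type w) (_ : L.Structure M') (f : M ↪[L] M') (hf : K.IsStrongEmb f),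
        Cardinal.lift.{max u v (w + 1)} lam <
          #{q' : K.GaType M' // q'.restrict f hf = q ∧
            ∀ (N : L.Substructure M') (hN : K.Strong M' N), #N ≤ lam →
              ih N (q'.restrictTo N hN)})
    (fun α _ ih M _ q => ∀ (β : Ordinal.{max u v (w + 1)}) (hβ : β < α), ih β hβ M q)

/-- `RM^lam[q] ≥ α` for a Galois type `q` over a model of any cardinality: `RM^lam[q]` is
the minimum of the ranks of the restrictions of `q` to strong submodels of size at most `lam`. -/
def RankGE (lam : Cardinal.{w}) (α : Ordinal.{max u v (w + 1)}) {M : Type w} [L.Structure M]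
    (q : K.GaType M) : Prop :=
  ∀ (N : L.Substructure M) (hN : K.Strong M N), #N ≤ lam →
    K.SmallRankGE lam α N (q.restrictTo N hN)

/-- `K` is `lam`-totally transcendental: `RM^lam[q]` is an ordinal (rather than `∞`) for every
Galois type `q` over a model in `K`. -/
def TotallyTranscendental (lam : Cardinal.{w}) : Prop :=
  ∀ (M : Type w) [L.Structure M], K.Mem M → ∀ q : K.GaType M,
    ∃ α : Ordinal.{max u v (w + 1)}, ¬ K.RankGE lam α q

end AEC

/-! The proof goes through total transcendence: stability in `lam` with `lam < lam ^ ℵ₀` forces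
`lam`-total transcendence, and `κ`-total transcendence forces stability in every infinite `μ = μ ^
κ`. The least `κ` then exists because the cardinals are well-ordered and `lam` qualifies.

First implication (`totallyTranscendental_of_stable`). The types form a small family, so some
ordinal `α` is so large that rank at least `α` already means rank `∞` (`exists_rank_bound`). Hence a
type of rank `∞` over a model of size at most `lam` has more than `lam` extensions of rank `∞` over
some model. By tameness, `lam` of these are separated by small submodels, which all fit into one
submodel of size at most `lam` (`UnrankedType.exists_split`). Iteration gives a `lam`-branching tree
of types of height `ω`. The models of the tree are amalgamated into one model
(`exists_list_amalgam`), and each branch is the restriction of a single type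
(`exists_gaType_of_seq`). This gives `lam ^ ℵ₀` types over a model of size `lam`, against stability.

Second implication (`stable_of_totallyTranscendental`). Each type `q` over `M` has the same rank as
its restriction to some strong submodel `N` of size at most `κ`. The map from `q` to `(N, q ↾ N)`
has fibres of size at most `κ`: a larger fibre would raise the rank of `q ↾ N`. There are at most `μ
^ κ = μ` submodels `N`, and at most `2 ^ κ ≤ μ` types over each (`mk_gaType_le_two_power`).

No monster model is used. Its role is played by amalgamation of trees of models, obtained by Zorn's
lemma from unions of arbitrary linearly ordered families of strong submodels. -/

namespace AEC

variable {L : FirstOrder.Language.{u, v}} {K : AEC.{u, v, w} L}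

/-! ### Strong embeddings and strong submodels -/

section StrongEmb

variable {M N P : Type w} [L.Structure M] [L.Structure N] [L.Structure P]

theorem IsStrongEmb.mem_cod {f : M ↪[L] N} (hf : K.IsStrongEmb f) : K.Mem N :=
  K.isAEC.mem_right _ _ hf

theorem IsStrongEmb.mem_dom {f : M ↪[L] N} (hf : K.IsStrongEmb f) : K.Mem M :=
  K.isAEC.mem_equiv _ _ f.equivRange.symm (K.isAEC.mem_left _ _ hf)

theorem isStrongEmb_equiv (e : M ≃[L] N) (h : K.Mem M) : K.IsStrongEmb e.toEmbedding := by
  have h1 := K.isAEC.strong_equiv _ _ e _ (K.isAEC.strong_top M h)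
  unfold IsStrongEmb
  convert h1 using 1
  ext x
  simp [Hom.mem_range, Substructure.mem_map]

theorem isStrongEmb_refl (h : K.Mem M) : K.IsStrongEmb (Embedding.refl L M) :=
  isStrongEmb_equiv (Language.Equiv.refl L M) h

/-- This is coherence in terms of embeddings: the axiom compares the two ranges inside `P`, and the
isomorphism of `N` with the range of `g` carries the result back. -/
theorem IsStrongEmb.of_comp {g : N ↪[L] P} {f : M ↪[L] N} (hg : K.IsStrongEmb g)
    (hgf : K.IsStrongEmb (g.comp f)) : K.IsStrongEmb f := by
  have hle : (g.comp f).toHom.range ≤ g.toHom.range := by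
    rintro _ ⟨x, rfl⟩
    exact ⟨f x, rfl⟩
  have h1 := (K.isAEC.coherence P _ _ hgf hg hle).2
  have h2 := K.isAEC.strong_equiv _ _ g.equivRange.symm _ h1
  unfold IsStrongEmb
  convert h2 using 1
  ext y
  simp only [Substructure.mem_map, Hom.mem_range, Substructure.mem_comap]
  constructor
  · rintro ⟨x, rfl⟩
    refine ⟨g.equivRange (f x), ⟨x, rfl⟩, ?_⟩
    exact g.equivRange.symm_apply_apply (f x)
  · rintro ⟨z, ⟨x, hx⟩, rfl⟩
    refine ⟨x, ?_⟩
    have : z = g.equivRange (f x) := Subtype.ext hx.symm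
    rw [this]
    exact (g.equivRange.symm_apply_apply (f x)).symm

theorem IsStrongEmb.codRestrict {f : M ↪[L] N} (hf : K.IsStrongEmb f) {T : L.Substructure N}
    (hT : K.Strong N T) (h : ∀ c, f c ∈ T) : K.IsStrongEmb (f.codRestrict T h) := by
  refine (isStrongEmb_subtype hT).of_comp ?_
  exact hf

theorem isStrongEmb_subtype_iff {S : L.Substructure M} :
    K.IsStrongEmb S.subtype ↔ K.Strong M S := by
  unfold IsStrongEmb
  rw [Substructure.range_subtype]

theorem strongLE_iff {S T : L.Substructure M} :
    K.StrongLE S T ↔ ∃ h : S ≤ T, K.IsStrongEmb (Substructure.inclusion h) := by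
  have key : ∀ h : S ≤ T,
      (Substructure.inclusion h).toHom.range = S.comap T.subtype.toHom := by
    intro h
    ext ⟨x, hx⟩
    simp only [Hom.mem_range, Substructure.mem_comap]
    constructor
    · rintro ⟨y, hy⟩
      have : (y : M) = x := congrArg Subtype.val hy
      change x ∈ S
      exact this ▸ y.2
    · intro hxS
      exact ⟨⟨x, hxS⟩, rfl⟩
  constructor
  · rintro ⟨h, h'⟩
    refine ⟨h, ?_⟩
    unfold IsStrongEmb
    rwa [key h]
  · rintro ⟨h, h'⟩
    refine ⟨h, ?_⟩
    unfold IsStrongEmb at h'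
    rwa [key h] at h'

theorem strongLE_refl {S : L.Substructure M} (h : K.Mem S) : K.StrongLE S S :=
  strongLE_iff.2 ⟨le_rfl, isStrongEmb_refl h⟩

theorem strongLE_trans {S T R : L.Substructure M} (h : K.StrongLE S T) (h' : K.StrongLE T R) :
    K.StrongLE S R := by
  obtain ⟨h1, h2⟩ := strongLE_iff.1 h
  obtain ⟨h1', h2'⟩ := strongLE_iff.1 h'
  exact strongLE_iff.2 ⟨h1.trans h1', h2'.comp h2⟩

theorem strongLE_top {S : L.Substructure M} : K.StrongLE S ⊤ ↔ K.Strong M S := by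
  rw [strongLE_iff]
  constructor
  · rintro ⟨h, hs⟩
    have := (isStrongEmb_equiv Substructure.topEquiv hs.mem_cod).comp hs
    exact isStrongEmb_subtype_iff.1 this
  · intro h
    have hM := K.isAEC.mem_right _ _ h
    refine ⟨le_top, ?_⟩
    have h1 : K.IsStrongEmb (⊤ : L.Substructure M).subtype :=
      isStrongEmb_subtype (K.isAEC.strong_top M hM)
    exact h1.of_comp (isStrongEmb_subtype h)

/-- A substructure of `R`, viewed as a substructure of the structure `R`. -/
def comapEquiv {S R : L.Substructure M} (h : S ≤ R) :
    S.comap R.subtype.toHom ≃[L] S where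
  toFun x := ⟨x.1.1, x.2⟩
  invFun x := ⟨⟨x.1, h x.2⟩, x.2⟩
  left_inv _ := rfl
  right_inv _ := rfl
  map_fun' _ _ := rfl
  map_rel' _ _ := Iff.rfl

theorem mem_comap_iff {S R : L.Substructure M} (h : S ≤ R) :
    K.Mem (S.comap R.subtype.toHom) ↔ K.Mem S :=
  ⟨K.isAEC.mem_equiv _ _ (comapEquiv h), K.isAEC.mem_equiv _ _ (comapEquiv h).symm⟩

theorem strongLE_comap {S T R : L.Substructure M} (hT : T ≤ R) (h : K.StrongLE S T) :
    K.StrongLE (S.comap R.subtype.toHom) (T.comap R.subtype.toHom) := by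
  obtain ⟨h1, h2⟩ := strongLE_iff.1 h
  refine strongLE_iff.2 ⟨fun x hx => h1 hx, ?_⟩
  have hS := h2.mem_dom
  have a1 := isStrongEmb_equiv (comapEquiv (h1.trans hT)) ((mem_comap_iff (h1.trans hT)).2 hS)
  have a2 := isStrongEmb_equiv (comapEquiv hT) ((mem_comap_iff hT).2 h2.mem_cod)
  exact a2.of_comp (h2.comp a1)

end StrongEmb

/-! ### Unions of chains that need not be continuous -/

section Unions

/-- `K` is closed under unions of (not necessarily continuous) chains of length `δ`. -/
def ClosedUnderChains (K : AEC.{u, v, w} L) (δ : Ordinal.{w}) : Prop :=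
  ∀ (M : Type w) [L.Structure M] (S : Ordinal.{w} → L.Substructure M) (T : L.Substructure M),
    (∀ α < δ, K.Mem (S α)) → (∀ α β, α < β → β < δ → K.StrongLE (S α) (S β)) →
    (T : Set M) = ⋃ α : Set.Iio δ, (S α.1 : Set M) →
    K.Mem T ∧ (∀ α < δ, K.StrongLE (S α) T) ∧
      ((∀ α < δ, K.Strong M (S α)) → K.Strong M T)

/-- The last clause of `ClosedUnderChains` concerns an ambient structure, so it is applied with `R`
itself as that structure. -/
theorem ClosedUnderChains.strongLE {δ : Ordinal.{w}} (hδ : K.ClosedUnderChains δ)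
    {M : Type w} [L.Structure M] {S : Ordinal.{w} → L.Substructure M} {T R : L.Substructure M}
    (hm : ∀ α < δ, K.Mem (S α)) (hi : ∀ α β, α < β → β < δ → K.StrongLE (S α) (S β))
    (hT : (T : Set M) = ⋃ α : Set.Iio δ, (S α.1 : Set M)) (hR : ∀ α < δ, K.StrongLE (S α) R) :
    K.StrongLE T R := by
  have hTR : T ≤ R := by
    intro x hx
    have : x ∈ (T : Set M) := hx
    rw [hT, Set.mem_iUnion] at this
    obtain ⟨⟨α, hα⟩, hxα⟩ := this
    exact (hR α hα).1 hxα
  refine ⟨hTR, ?_⟩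
  refine (hδ R (fun α => (S α).comap R.subtype.toHom) (T.comap R.subtype.toHom) ?_ ?_ ?_).2.2 ?_
  · intro α hα
    exact (mem_comap_iff (hR α hα).1).2 (hm α hα)
  · intro α β hαβ hβ
    exact strongLE_comap (hR β hβ).1 (hi α β hαβ hβ)
  · ext x
    have := Set.ext_iff.1 hT x.1
    simpa using this
  · intro α hα
    exact (hR α hα).2

/-- The axioms cover continuous chains only. By induction on `δ`, the members at limit indices can
be replaced by the unions of the earlier ones. The new chain `U` is continuous and interleaves with
`S` (`S α ≺ U β ≺ S β` for `α < β`), so for limit `δ` both have the same union. -/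
theorem closedUnderChains (K : AEC.{u, v, w} L) (δ : Ordinal.{w}) (hδ : 0 < δ) :
    K.ClosedUnderChains δ := by
  induction δ using WellFoundedLT.induction with
  | ind δ ih =>
  intro M _ S T hm hi hT
  rcases Ordinal.zero_or_succ_or_isSuccLimit δ with rfl | ⟨γ, rfl⟩ | hlim
  · exact absurd hδ (lt_irrefl _)
  · have hγ : γ < Order.succ γ := Order.lt_succ γ
    have hTS : T = S γ := by
      apply SetLike.coe_injective
      rw [hT]
      apply Set.Subset.antisymm
      · refine Set.iUnion_subset ?_
        rintro ⟨α, hα⟩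
        rcases (Order.lt_succ_iff.1 (Set.mem_Iio.1 hα)).lt_or_eq with h | rfl
        · exact (hi _ _ h hγ).1
        · exact subset_rfl
      · exact Set.subset_iUnion_of_subset ⟨γ, hγ⟩ subset_rfl
    subst hTS
    refine ⟨hm _ hγ, ?_, fun h => h _ hγ⟩
    intro α hα
    rcases (Order.lt_succ_iff.1 hα).lt_or_eq with h | rfl
    · exact hi _ _ h hγ
    · exact strongLE_refl (hm _ hγ)
  · classical
    let U : Ordinal.{w} → L.Substructure M := fun α =>
      if Order.IsSuccLimit α then ⨆ β : Set.Iio α, S β.1 else S α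
    have hUlim : ∀ α, Order.IsSuccLimit α → U α = ⨆ β : Set.Iio α, S β.1 :=
      fun α h => if_pos h
    have hUnot : ∀ α, ¬ Order.IsSuccLimit α → U α = S α := fun α h => if_neg h
    have hcoe : ∀ α, α < δ → Order.IsSuccLimit α →
        ((⨆ β : Set.Iio α, S β.1 : L.Substructure M) : Set M) =
          ⋃ β : Set.Iio α, (S β.1 : Set M) := by
      intro α hα hl
      have : Nonempty (Set.Iio α) := ⟨⟨0, hl.bot_lt⟩⟩
      ext x
      rw [SetLike.mem_coe, Substructure.mem_iSup_of_directed]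
      · simp
      · intro a b
        rcases lt_trichotomy a.1 b.1 with h | h | h
        · exact ⟨b, (hi _ _ h (b.2.trans hα)).1, le_rfl⟩
        · exact ⟨b, (congrArg S h).le, le_rfl⟩
        · exact ⟨a, le_rfl, (hi _ _ h (a.2.trans hα)).1⟩
    have hcl : ∀ α, α < δ → Order.IsSuccLimit α → K.ClosedUnderChains α :=
      fun α hα hl => ih α hα hl.bot_lt
    have hm' : ∀ α, α < δ → ∀ β < α, K.Mem (S β) := fun α hα β hβ => hm β (hβ.trans hα)
    have hi' : ∀ α, α < δ → ∀ β γ, β < γ → γ < α → K.StrongLE (S β) (S γ) :=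
      fun α hα β γ h h' => hi β γ h (h'.trans hα)
    have hUmem : ∀ α, α < δ → K.Mem (U α) := by
      intro α hα
      by_cases hl : Order.IsSuccLimit α
      · rw [hUlim α hl]
        exact (hcl α hα hl M S _ (hm' α hα) (hi' α hα) (hcoe α hα hl)).1
      · rw [hUnot α hl]
        exact hm α hα
    have hSU : ∀ α β, α < β → β < δ → K.StrongLE (S α) (U β) := by
      intro α β h hβ
      by_cases hl : Order.IsSuccLimit β
      · rw [hUlim β hl]
        exact (hcl β hβ hl M S _ (hm' β hβ) (hi' β hβ) (hcoe β hβ hl)).2.1 α h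
      · rw [hUnot β hl]
        exact hi α β h hβ
    have hUS : ∀ α, α < δ → K.StrongLE (U α) (S α) := by
      intro α hα
      by_cases hl : Order.IsSuccLimit α
      · rw [hUlim α hl]
        exact (hcl α hα hl).strongLE (hm' α hα) (hi' α hα) (hcoe α hα hl)
          (fun β hβ => hi β α hβ hα)
      · rw [hUnot α hl]
        exact strongLE_refl (hm α hα)
    have hsucc : ∀ α, U (Order.succ α) = S (Order.succ α) :=
      fun α => hUnot _ (fun h => h.succ_ne α rfl)
    have hchain : K.IsChain δ U := by
      refine ⟨hUmem, fun α β h hβ => strongLE_trans (hUS α (h.trans hβ)) (hSU α β h hβ), ?_⟩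
      intro α hα hl
      rw [hUlim α hl, hcoe α hα hl]
      apply Set.Subset.antisymm
      · refine Set.iUnion_subset ?_
        rintro ⟨β, hβ⟩
        have hs := hl.succ_lt hβ
        refine Set.subset_iUnion_of_subset ⟨Order.succ β, hs⟩ ?_
        exact (hSU _ _ (Order.lt_succ β) (hs.trans hα)).1
      · refine Set.iUnion_subset ?_
        rintro ⟨β, hβ⟩
        exact Set.subset_iUnion_of_subset ⟨β, hβ⟩ (hUS β (hβ.trans hα)).1
    have hTU : (T : Set M) = ⋃ α : Set.Iio δ, (U α.1 : Set M) := by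
      rw [hT]
      apply Set.Subset.antisymm
      · refine Set.iUnion_subset ?_
        rintro ⟨β, hβ⟩
        have hs := hlim.succ_lt hβ
        refine Set.subset_iUnion_of_subset ⟨Order.succ β, hs⟩ ?_
        exact (hSU _ _ (Order.lt_succ β) hs).1
      · refine Set.iUnion_subset ?_
        rintro ⟨β, hβ⟩
        exact Set.subset_iUnion_of_subset ⟨β, hβ⟩ (hUS β hβ).1
    refine ⟨K.isAEC.union_mem M δ U T hδ hchain hTU, ?_, ?_⟩
    · intro α hα
      have hs := hlim.succ_lt hα
      exact strongLE_trans (hSU _ _ (Order.lt_succ α) hs)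
        (K.isAEC.strong_union M δ U T hδ hchain hTU _ hs)
    · intro h
      refine K.isAEC.union_strong M δ U T hδ hchain hTU ?_
      intro α hα
      exact K.isAEC.strong_trans M _ _ (hUS α hα) (h α hα)

/-- Unions of linearly ordered families of strong submodels. -/
theorem union_of_total {M : Type w} [L.Structure M] {ι : Type w} [Nonempty ι]
    (S : ι → L.Substructure M) (T : L.Substructure M) (hm : ∀ i, K.Mem (S i))
    (htot : ∀ i j, K.StrongLE (S i) (S j) ∨ K.StrongLE (S j) (S i))
    (hT : (T : Set M) = ⋃ i, (S i : Set M)) :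
    K.Mem T ∧ (∀ i, K.StrongLE (S i) T) ∧ ((∀ i, K.Strong M (S i)) → K.Strong M T) := by
  classical
  let r : ι → ι → Prop := WellOrderingRel
  -- For a well-order `r` of the indices, keep those whose member is contained in no earlier member.
  -- On `R` the family increases along `r`, and `R` is cofinal: the `r`-least `k` with `S i ≺ S k`
  -- lies in it.
  let R : Set ι := {i | ∀ j, r j i → ¬ S i ≤ S j}
  have hcof : ∀ i, ∃ k ∈ R, K.StrongLE (S i) (S k) := by
    intro i
    have hwf : WellFounded r := WellOrderingRel.isWellOrder.wf
    let A : Set ι := {k | K.StrongLE (S i) (S k)}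
    have hA : A.Nonempty := ⟨i, strongLE_refl (hm i)⟩
    refine ⟨hwf.min A hA, ?_, hwf.min_mem A hA⟩
    intro j hj hle
    have h1 : K.StrongLE (S i) (S (hwf.min A hA)) := hwf.min_mem A hA
    have h2 : j ∉ A := fun hjA => hwf.not_lt_min A hjA hj
    rcases htot i j with h | h
    · exact h2 h
    · have : S i = S j := le_antisymm (h1.1.trans hle) h.1
      apply h2
      change K.StrongLE (S i) (S j)
      rw [← this]
      exact strongLE_refl (hm i)
  let r' : R → R → Prop := Subrel r (· ∈ R)
  have hwo : IsWellOrder R r' := inferInstance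
  have hRne : Nonempty R := by
    obtain ⟨k, hk, -⟩ := hcof (Classical.arbitrary ι)
    exact ⟨⟨k, hk⟩⟩
  let δ : Ordinal.{w} := Ordinal.type r'
  have hδ : 0 < δ := pos_iff_ne_zero.2 (Ordinal.type_ne_zero_iff_nonempty.2 hRne)
  let e := Ordinal.enum r'
  let S' : Ordinal.{w} → L.Substructure M := fun α =>
    if h : α < δ then S (e ⟨α, h⟩).1 else ⊥
  have hS' : ∀ α (h : α < δ), S' α = S (e ⟨α, h⟩).1 := fun α h => dif_pos h
  have hsurj : ∀ k : R, ∃ α, ∃ h : α < δ, S' α = S k.1 := by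
    intro k
    refine ⟨(e.symm k).1, (e.symm k).2, ?_⟩
    rw [hS' _ (e.symm k).2]
    congr 2
    exact e.apply_symm_apply k
  have hm' : ∀ α < δ, K.Mem (S' α) := by
    intro α hα
    rw [hS' α hα]
    exact hm _
  have hi' : ∀ α β, α < β → β < δ → K.StrongLE (S' α) (S' β) := by
    intro α β h hβ
    rw [hS' α (h.trans hβ), hS' β hβ]
    have h1 : r' (e ⟨α, h.trans hβ⟩) (e ⟨β, hβ⟩) := Ordinal.enum_lt_enum.2 h
    have h2 := (e ⟨β, hβ⟩).2 _ h1
    rcases htot (e ⟨α, h.trans hβ⟩).1 (e ⟨β, hβ⟩).1 with h3 | h3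
    · exact h3
    · exact absurd h3.1 h2
  have hT' : (T : Set M) = ⋃ α : Set.Iio δ, (S' α.1 : Set M) := by
    rw [hT]
    apply Set.Subset.antisymm
    · refine Set.iUnion_subset fun i => ?_
      obtain ⟨k, hk, hik⟩ := hcof i
      obtain ⟨α, hα, hα'⟩ := hsurj ⟨k, hk⟩
      refine Set.subset_iUnion_of_subset ⟨α, hα⟩ ?_
      change (S i : Set M) ⊆ S' α
      rw [hα']
      exact hik.1
    · refine Set.iUnion_subset ?_
      rintro ⟨α, hα⟩
      refine Set.subset_iUnion_of_subset (e ⟨α, hα⟩).1 ?_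
      change (S' α : Set M) ⊆ _
      rw [hS' α hα]
  obtain ⟨h1, h2, h3⟩ := K.closedUnderChains δ hδ M S' T hm' hi' hT'
  refine ⟨h1, fun i => ?_, fun h => h3 fun α hα => ?_⟩
  · obtain ⟨k, hk, hik⟩ := hcof i
    obtain ⟨α, hα, hα'⟩ := hsurj ⟨k, hk⟩
    have := h2 α hα
    rw [hα'] at this
    exact strongLE_trans hik this
  · rw [hS' α hα]
    exact h _

end Unions

/-! ### Direct limits of linearly ordered systems of strong embeddings -/

section DirectLimits

variable {ι : Type w} [Preorder ι] [IsDirectedOrder ι] [Nonempty ι]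
  {G : ι → Type w} [∀ i, L.Structure (G i)] (f : ∀ i j, i ≤ j → G i ↪[L] G j)
  [DirectedSystem G fun i j h => f i j h]

theorem strongLE_range_of {N : Type w} [L.Structure N] {A B : Type w} [L.Structure A]
    [L.Structure B] {f : A ↪[L] B} (hf : K.IsStrongEmb f) (g : B ↪[L] N) (g' : A ↪[L] N)
    (h : g.comp f = g') : K.StrongLE g'.toHom.range g.toHom.range := by
  subst h
  have hle : (g.comp f).toHom.range ≤ g.toHom.range := by
    rintro _ ⟨x, rfl⟩
    exact ⟨f x, rfl⟩
  refine strongLE_iff.2 ⟨hle, ?_⟩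
  have h1 : K.IsStrongEmb (g.comp f).equivRange.symm.toEmbedding :=
    isStrongEmb_equiv _ (K.isAEC.mem_equiv _ _ (g.comp f).equivRange hf.mem_dom)
  have h2 : K.IsStrongEmb g.equivRange.toEmbedding := isStrongEmb_equiv _ hf.mem_cod
  convert h2.comp (hf.comp h1) using 1
  ext x
  obtain ⟨y, rfl⟩ := (g.comp f).equivRange.surjective x
  change ((g.comp f).equivRange y).1 = g (f ((g.comp f).equivRange.symm ((g.comp f).equivRange y)))
  rw [Language.Equiv.symm_apply_apply]
  rfl

/-- The ranges of the canonical maps form a linearly ordered family of models that covers the limit.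
-/
theorem directLimit_strong (htot : ∀ i j : ι, i ≤ j ∨ j ≤ i)
    (hf : ∀ i j h, K.IsStrongEmb (f i j h)) :
    K.Mem (Language.DirectLimit G f) ∧ ∀ i, K.IsStrongEmb (Language.DirectLimit.of L ι G f i) := by
  have hm : ∀ i, K.Mem (G i) := fun i => (hf i i le_rfl).mem_dom
  have h := union_of_total (K := K) (fun i => (Language.DirectLimit.of L ι G f i).toHom.range) ⊤
    (fun i => K.isAEC.mem_equiv _ _ (Language.DirectLimit.of L ι G f i).equivRange (hm i)) ?_ ?_
  · refine ⟨K.isAEC.mem_equiv _ _ Substructure.topEquiv h.1, fun i => ?_⟩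
    exact strongLE_top.1 (h.2.1 i)
  · intro i j
    rcases htot i j with hij | hij
    · left
      refine strongLE_range_of (hf i j hij) _ _ ?_
      ext x
      exact Language.DirectLimit.of_f
    · right
      refine strongLE_range_of (hf j i hij) _ _ ?_
      ext x
      exact Language.DirectLimit.of_f
  · ext z
    obtain ⟨i, x, rfl⟩ := Language.DirectLimit.exists_of z
    simp only [Substructure.coe_top, Set.mem_univ, true_iff, Set.mem_iUnion]
    exact ⟨i, x, rfl⟩

/-- The range of the lift is the union of the ranges of the `g i`, all of which are strong in `N`.
-/
theorem directLimit_lift_strong (htot : ∀ i j : ι, i ≤ j ∨ j ≤ i)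
    (hf : ∀ i j h, K.IsStrongEmb (f i j h)) {N : Type w} [L.Structure N]
    (g : ∀ i, G i ↪[L] N) (hg : ∀ i, K.IsStrongEmb (g i))
    (hgf : ∀ i j hij x, g j (f i j hij x) = g i x) :
    K.IsStrongEmb (Language.DirectLimit.lift L ι G f g hgf) := by
  have h := union_of_total (K := K) (fun i => (g i).toHom.range)
    (Language.DirectLimit.lift L ι G f g hgf).toHom.range
    (fun i => K.isAEC.mem_left _ _ (hg i)) ?_ ?_
  · exact h.2.2 hg
  · intro i j
    rcases htot i j with hij | hij
    · left
      refine strongLE_range_of (hf i j hij) _ _ ?_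
      ext x
      exact hgf _ _ _ _
    · right
      refine strongLE_range_of (hf j i hij) _ _ ?_
      ext x
      exact hgf _ _ _ _
  · ext z
    simp only [SetLike.mem_coe, Hom.mem_range, Set.mem_iUnion]
    constructor
    · rintro ⟨x, rfl⟩
      obtain ⟨i, y, rfl⟩ := Language.DirectLimit.exists_of x
      exact ⟨i, y, (Language.DirectLimit.lift_of g hgf y).symm⟩
    · rintro ⟨i, y, rfl⟩
      exact ⟨Language.DirectLimit.of L ι G f i y, DirectLimit.lift_of g hgf y⟩

end DirectLimits

/-! ### Small strong submodels -/

theorem isLSBound_of_le {κ : Cardinal.{w}} (h : K.LS ≤ κ) : K.IsLSBound κ := by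
  have h0 : K.IsLSBound K.LS := csInf_mem (s := {κ | K.IsLSBound κ}) K.isAEC.exists_isLSBound
  refine ⟨h0.1.trans h, fun M _ hM A => ?_⟩
  obtain ⟨S, h1, h2, h3⟩ := h0.2 M hM A
  exact ⟨S, h1, h2, h3.trans (by gcongr)⟩

theorem exists_strong_superset {κ : Cardinal.{w}} (h : K.LS ≤ κ) {M : Type w} [L.Structure M]
    (hM : K.Mem M) (A : Set M) (hA : #A ≤ κ) :
    ∃ S : L.Substructure M, K.Strong M S ∧ A ⊆ S ∧ #S ≤ κ := by
  have hb := isLSBound_of_le h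
  obtain ⟨S, h1, h2, h3⟩ := hb.2 M hM A
  exact ⟨S, h1, h2, h3.trans (add_le_of_le hb.1 hA le_rfl)⟩

/-- Transport of a structure along an injection. -/
theorem exists_structure_range {Q X : Type w} [L.Structure Q] {ψ : Q → X}
    (hψ : Function.Injective ψ) :
    ∃ (_ : L.Structure (Set.range ψ)) (e : Q ≃[L] Set.range ψ), ∀ x, (e x : X) = ψ x :=
  ⟨(Equiv.ofInjective ψ hψ).inducedStructure, (Equiv.ofInjective ψ hψ).inducedStructureEquiv,
    fun _ => rfl⟩

/-! ### Amalgamation of trees of models -/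

section Tree

variable {I : Type w} (K) (N : Option I → Type w) [∀ v, L.Structure (N v)]
  (par : I → Option I) (f : ∀ i, N (par i) ↪[L] N (some i)) (Y : Type w)

/-- A cocone over a part (closed under parents) of a tree of models, the vertex of which has its
underlying set inside `Option I × Y`. -/
structure PartialCocone where
  J : Set (Option I)
  S : Set (Option I × Y)
  [str : L.Structure S]
  g : ∀ v, N v → Option I × Y
  none_mem : none ∈ J
  par_mem : ∀ i, some i ∈ J → par i ∈ J
  fst_mem : ∀ x ∈ S, x.1 ∈ J
  strong : ∀ v ∈ J, ∃ e : N v ↪[L] S, K.IsStrongEmb e ∧ ∀ x, (e x : Option I × Y) = g v x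
  compat : ∀ i, some i ∈ J → ∀ x, g (some i) (f i x) = g (par i) x

attribute [instance] PartialCocone.str

variable {K N par f Y}

namespace PartialCocone

theorem mem (p : PartialCocone K N par f Y) : K.Mem p.S := by
  obtain ⟨e, he, -⟩ := p.strong none p.none_mem
  exact he.mem_cod

/-- `q` extends `p`. -/
def Le (p q : PartialCocone K N par f Y) : Prop :=
  p.J ⊆ q.J ∧ (∀ v ∈ p.J, p.g v = q.g v) ∧
    ∃ e : p.S ↪[L] q.S, K.IsStrongEmb e ∧ ∀ x, (e x : Option I × Y) = x

theorem Le.refl (p : PartialCocone K N par f Y) : p.Le p :=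
  ⟨subset_rfl, fun _ _ => rfl, Embedding.refl L _, isStrongEmb_refl p.mem, fun _ => rfl⟩

theorem Le.trans {p q r : PartialCocone K N par f Y} (h : p.Le q) (h' : q.Le r) : p.Le r := by
  obtain ⟨h1, h2, e, h3, h4⟩ := h
  obtain ⟨h1', h2', e', h3', h4'⟩ := h'
  refine ⟨h1.trans h1', fun v hv => (h2 v hv).trans (h2' v (h1 hv)), e'.comp e, h3'.comp h3, ?_⟩
  intro x
  rw [Embedding.comp_apply, h4', h4]

/-- If `q.Le p`, the inclusion of `q.S` in `p.S` is onto and therefore an isomorphism, which can be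
inverted. So within a chain the underlying set determines the structure on the vertex. -/
theorem exists_emb_of_subset {p q : PartialCocone K N par f Y} (h : p.Le q ∨ q.Le p)
    (hS : p.S ⊆ q.S) :
    ∃ e : p.S ↪[L] q.S, K.IsStrongEmb e ∧ ∀ x, (e x : Option I × Y) = x := by
  rcases h with h | h
  · exact h.2.2
  · obtain ⟨-, -, e, he, hev⟩ := h
    have hb : Function.Bijective e := by
      refine ⟨e.injective, fun x => ?_⟩
      exact ⟨⟨x, hS x.2⟩, Subtype.ext (hev _)⟩
    let E : q.S ≃[L] p.S :=
      { Equiv.ofBijective e hb with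
        map_fun' := fun F x => e.map_fun F x
        map_rel' := fun R x => e.map_rel R x }
    refine ⟨E.symm.toEmbedding, isStrongEmb_equiv _ p.mem, fun x => ?_⟩
    obtain ⟨y, rfl⟩ := E.surjective x
    change ((E.symm (E y) : q.S) : Option I × Y) = (e y : Option I × Y)
    rw [Language.Equiv.symm_apply_apply, hev]

theorem exists_le_of_chain (c : Set (PartialCocone K N par f Y)) (hc : _root_.IsChain Le c)
    (hne : c.Nonempty) : ∃ ub : PartialCocone K N par f Y, ∀ p ∈ c, p.Le ub := by
  classical
  have hcmp : ∀ p ∈ c, ∀ q ∈ c, p.Le q ∨ q.Le p := by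
    intro p hp q hq
    by_cases hpq : p = q
    · subst hpq
      exact Or.inl (Le.refl p)
    · exact hc hp hq hpq
  have hgeq : ∀ p ∈ c, ∀ q ∈ c, ∀ v ∈ p.J, v ∈ q.J → p.g v = q.g v := by
    intro p hp q hq v hvp hvq
    rcases hcmp p hp q hq with h | h
    · exact h.2.1 v hvp
    · exact (h.2.1 v hvq).symm
  have hsub : ∀ p ∈ c, ∀ q ∈ c, p.S ⊆ q.S ∨ q.S ⊆ p.S := by
    have key : ∀ p q : PartialCocone K N par f Y, p.Le q → p.S ⊆ q.S := by
      rintro p q ⟨-, -, e, -, he⟩ x hx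
      have := (e ⟨x, hx⟩).2
      rwa [he] at this
    intro p hp q hq
    exact (hcmp p hp q hq).imp (key p q) (key q p)
  -- The chain itself may live in a larger universe than `Type w`. Indexing by the underlying sets
  -- of the vertices brings the direct system into `Type w`, with one chosen cocone for each set.
  let ι : Type w := {T : Set (Option I × Y) // ∃ p ∈ c, p.S = T}
  obtain ⟨p0, hp0⟩ := hne
  have : Nonempty ι := ⟨⟨p0.S, p0, hp0, rfl⟩⟩
  let P : ι → PartialCocone K N par f Y := fun T => T.2.choose
  have hPc : ∀ T, P T ∈ c := fun T => T.2.choose_spec.1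
  have hPS : ∀ T, (P T).S = T.1 := fun T => T.2.choose_spec.2
  have htot : ∀ T T' : ι, T ≤ T' ∨ T' ≤ T := by
    intro T T'
    have := hsub _ (hPc T) _ (hPc T')
    rwa [hPS, hPS] at this
  have : IsDirectedOrder ι := ⟨fun a b => by
    rcases htot a b with h | h
    · exact ⟨b, h, le_rfl⟩
    · exact ⟨a, le_rfl, h⟩⟩
  have hex : ∀ T T' : ι, T ≤ T' →
      ∃ e : (P T).S ↪[L] (P T').S, K.IsStrongEmb e ∧ ∀ x, (e x : Option I × Y) = x := by
    intro T T' h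
    refine exists_emb_of_subset (hcmp _ (hPc T) _ (hPc T')) ?_
    rw [hPS, hPS]
    exact h
  let F : ∀ T T' : ι, T ≤ T' → (P T).S ↪[L] (P T').S := fun T T' h => (hex T T' h).choose
  have hFs : ∀ T T' h, K.IsStrongEmb (F T T' h) := fun T T' h => (hex T T' h).choose_spec.1
  have hFv : ∀ T T' h x, (F T T' h x : Option I × Y) = x :=
    fun T T' h => (hex T T' h).choose_spec.2
  have : DirectedSystem (fun T => (P T).S) fun i j h => F i j h :=
    ⟨fun T x => Subtype.ext (hFv T T le_rfl x),
      fun T T' T'' h h' x => Subtype.ext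
        ((hFv _ _ h' _).trans ((hFv _ _ h _).trans (hFv _ _ (h.trans h') _).symm))⟩
  obtain ⟨hDm, hDs⟩ := directLimit_strong (K := K) F htot hFs
  let D := Language.DirectLimit (fun T => (P T).S) F
  let of := fun T => Language.DirectLimit.of L ι (fun T => (P T).S) F T
  have hval : ∀ T T' (x : (P T).S) (y : (P T').S),
      of T x = of T' y ↔ (x : Option I × Y) = y := by
    have aux : ∀ T T' (h : T ≤ T') (x : (P T).S) (y : (P T').S),
        of T x = of T' y ↔ (x : Option I × Y) = y := by
      intro T T' h x y
      have : of T x = of T' (F T T' h x) := (Language.DirectLimit.of_f (hij := h)).symm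
      rw [this, (of T').injective.eq_iff, Subtype.ext_iff, hFv T T' h x]
    intro T T' x y
    rcases htot T T' with h | h
    · exact aux T T' h x y
    · rw [eq_comm, aux T' T h, eq_comm]
  have hex' : ∀ d : D, ∃ T, ∃ x : (P T).S, of T x = d :=
    fun d => Language.DirectLimit.exists_of d
  choose τ ξ hτ using hex'
  -- The direct limit is renamed so that its underlying set is the union of the vertices; the
  -- embeddings of the vertices become inclusions.
  let φ : D → Option I × Y := fun d => (ξ d : Option I × Y)
  have hφ : ∀ T x, φ (of T x) = x := fun T x => (hval _ _ _ _).1 (hτ (of T x))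
  have hφi : Function.Injective φ := by
    intro d d' h
    rw [← hτ d, ← hτ d']
    exact (hval _ _ _ _).2 h
  obtain ⟨str, e, he⟩ := exists_structure_range (L := L) hφi
  have hes : K.IsStrongEmb e.toEmbedding := isStrongEmb_equiv e hDm
  have hemb : ∀ p ∈ c, ∃ e' : p.S ↪[L] Set.range φ,
      K.IsStrongEmb e' ∧ ∀ x, (e' x : Option I × Y) = x := by
    intro p hp
    let T : ι := ⟨p.S, p, hp, rfl⟩
    obtain ⟨k, hk, hkv⟩ := exists_emb_of_subset (hcmp p hp _ (hPc T)) (by rw [hPS T])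
    refine ⟨e.toEmbedding.comp ((of T).comp k), hes.comp ((hDs T).comp hk), fun x => ?_⟩
    have : (e (of T (k x)) : Option I × Y) = x := by rw [he, hφ, hkv]
    exact this
  let J : Set (Option I) := ⋃ p ∈ c, p.J
  have hJ : ∀ v, v ∈ J ↔ ∃ p ∈ c, v ∈ p.J := fun v => by simp [J]
  -- Off `J` the value is arbitrary: no condition on a cocone looks at it.
  let g : ∀ v, N v → Option I × Y := fun v =>
    if h : ∃ p ∈ c, v ∈ p.J then h.choose.g v else p0.g v
  have hg : ∀ p ∈ c, ∀ v ∈ p.J, p.g v = g v := by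
    intro p hp v hv
    have h : ∃ p ∈ c, v ∈ p.J := ⟨p, hp, hv⟩
    have : g v = h.choose.g v := dif_pos h
    rw [this]
    exact hgeq _ hp _ h.choose_spec.1 v hv h.choose_spec.2
  refine ⟨{ J := J, S := Set.range φ, g := g, none_mem := ?_, par_mem := ?_, fst_mem := ?_,
            strong := ?_, compat := ?_ }, ?_⟩
  · exact (hJ _).2 ⟨p0, hp0, p0.none_mem⟩
  · intro i hi
    obtain ⟨p, hp, hip⟩ := (hJ _).1 hi
    exact (hJ _).2 ⟨p, hp, p.par_mem i hip⟩
  · rintro _ ⟨d, rfl⟩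
    exact (hJ _).2 ⟨P (τ d), hPc _, (P (τ d)).fst_mem _ (ξ d).2⟩
  · intro v hv
    obtain ⟨p, hp, hvp⟩ := (hJ _).1 hv
    obtain ⟨k, hk, hkv⟩ := p.strong v hvp
    obtain ⟨e', he', hev'⟩ := hemb p hp
    refine ⟨e'.comp k, he'.comp hk, fun x => ?_⟩
    rw [Embedding.comp_apply, hev', hkv, hg p hp v hvp]
  · intro i hi x
    obtain ⟨p, hp, hip⟩ := (hJ _).1 hi
    rw [← hg p hp _ hip, ← hg p hp _ (p.par_mem i hip), p.compat i hip]
  · intro p hp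
    exact ⟨fun v hv => (hJ _).2 ⟨p, hp, hv⟩, hg p hp, hemb p hp⟩

/-- Amalgamate the vertex with the new model over the parent, cut the result down to size at most
`#Y`, and rename it inside `Option I × Y`. Old elements keep their names. New ones get first
coordinate `some i`, which `fst_mem` guarantees to be unused. -/
theorem exists_le_insert (hAP : K.Amalgamation) (hf : ∀ i, K.IsStrongEmb (f i))
    (hI : #(Option I) ≤ #Y) (hN : ∀ v, #(N v) ≤ #Y) (hLS : K.LS ≤ #Y)
    (p : PartialCocone K N par f Y) (i : I) (hi : some i ∉ p.J) (hpar : par i ∈ p.J) :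
    ∃ q : PartialCocone K N par f Y, p.Le q ∧ some i ∈ q.J := by
  classical
  have hω : ℵ₀ ≤ #Y := (isLSBound_of_le hLS).1
  obtain ⟨e, he, hev⟩ := p.strong _ hpar
  obtain ⟨Q, _, h1, h2, hh1, hh2, hcomm⟩ := hAP _ _ _ e (f i) he (hf i)
  have hpS : #p.S ≤ #Y := by
    refine (mk_set_le p.S).trans ?_
    rw [mk_prod, lift_id, lift_id]
    exact (mul_le_mul_left hI _).trans (mul_eq_self hω).le
  obtain ⟨R, hR, hAR, hRY⟩ := exists_strong_superset hLS hh1.mem_cod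
    (Set.range h1 ∪ Set.range h2) ((mk_union_le _ _).trans
      (add_le_of_le hω (mk_range_le.trans hpS) (mk_range_le.trans (hN _))))
  have hR1 : ∀ x, h1 x ∈ R := fun x => hAR (Or.inl ⟨x, rfl⟩)
  have hR2 : ∀ x, h2 x ∈ R := fun x => hAR (Or.inr ⟨x, rfl⟩)
  let k1 := h1.codRestrict R hR1
  let k2 := h2.codRestrict R hR2
  have hk1 : K.IsStrongEmb k1 := hh1.codRestrict hR hR1
  have hk2 : K.IsStrongEmb k2 := hh2.codRestrict hR hR2
  have hkc : ∀ x, k1 (e x) = k2 (f i x) := fun x => Subtype.ext (DFunLike.congr_fun hcomm x)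
  obtain ⟨ρ⟩ : Nonempty (R ↪ Y) := hRY
  let ψ : R → Option I × Y := fun r =>
    if h : ∃ x, k1 x = r then (h.choose : Option I × Y) else (some i, ρ r)
  have hψ1 : ∀ x, ψ (k1 x) = x := by
    intro x
    have h : ∃ y, k1 y = k1 x := ⟨x, rfl⟩
    have h' : ψ (k1 x) = (h.choose : Option I × Y) := dif_pos h
    rw [h', k1.injective h.choose_spec]
  have hψ2 : ∀ r, (¬ ∃ x, k1 x = r) → ψ r = (some i, ρ r) := fun r h => dif_neg h
  have hψi : Function.Injective ψ := by
    intro r r' hrr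
    by_cases h : ∃ x, k1 x = r <;> by_cases h' : ∃ x, k1 x = r'
    · obtain ⟨x, rfl⟩ := h
      obtain ⟨y, rfl⟩ := h'
      rw [hψ1, hψ1] at hrr
      rw [Subtype.ext hrr]
    · obtain ⟨x, rfl⟩ := h
      rw [hψ1, hψ2 _ h'] at hrr
      have hx := p.fst_mem _ x.2
      rw [hrr] at hx
      exact absurd hx hi
    · obtain ⟨x, rfl⟩ := h'
      rw [hψ1, hψ2 _ h] at hrr
      have hx := p.fst_mem _ x.2
      rw [← hrr] at hx
      exact absurd hx hi
    · rw [hψ2 _ h, hψ2 _ h'] at hrr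
      exact ρ.injective (Prod.ext_iff.1 hrr).2
  obtain ⟨str, E, hE⟩ := exists_structure_range (L := L) hψi
  have hEs : K.IsStrongEmb E.toEmbedding := isStrongEmb_equiv E hk1.mem_cod
  have hSE : K.IsStrongEmb (E.toEmbedding.comp k1) := hEs.comp hk1
  have hSv : ∀ x, (E.toEmbedding.comp k1 x : Option I × Y) = x := by
    intro x
    exact (hE _).trans (hψ1 x)
  let g : ∀ v, N v → Option I × Y := Function.update p.g (some i) (fun x => ψ (k2 x))
  have hgi : g (some i) = fun x => ψ (k2 x) := Function.update_self _ _ _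
  have hg : ∀ v ∈ p.J, p.g v = g v := by
    intro v hv
    have : v ≠ some i := fun h => hi (h ▸ hv)
    exact (Function.update_of_ne this _ _).symm
  refine ⟨{ J := insert (some i) p.J, S := Set.range ψ, g := g,
            none_mem := Or.inr p.none_mem, par_mem := ?_, fst_mem := ?_,
            strong := ?_, compat := ?_ }, ⟨fun v hv => Or.inr hv, hg, _, hSE, hSv⟩, Or.inl rfl⟩
  · rintro j (hj | hj)
    · rw [Option.some_inj.1 hj]
      exact Or.inr hpar
    · exact Or.inr (p.par_mem j hj)
  · rintro _ ⟨r, rfl⟩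
    by_cases h : ∃ x, k1 x = r
    · obtain ⟨x, rfl⟩ := h
      rw [hψ1]
      exact Or.inr (p.fst_mem _ x.2)
    · rw [hψ2 _ h]
      exact Or.inl rfl
  · rintro v (rfl | hv)
    · refine ⟨E.toEmbedding.comp k2, hEs.comp hk2, fun x => ?_⟩
      rw [hgi]
      exact hE _
    · obtain ⟨k, hk, hkv⟩ := p.strong v hv
      refine ⟨(E.toEmbedding.comp k1).comp k, hSE.comp hk, fun x => ?_⟩
      rw [Embedding.comp_apply, hSv, hkv, hg v hv]
  · rintro j (hj | hj) x
    · obtain rfl := Option.some_inj.1 hj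
      rw [hgi, ← hg _ hpar, ← hev x]
      change ψ (k2 (f j x)) = _
      rw [← hkc, hψ1]
    · rw [← hg _ hj, ← hg _ (p.par_mem j hj), p.compat j hj]

end PartialCocone

/-- Trees of models can be amalgamated. -/
theorem exists_tree_amalgam (hAP : K.Amalgamation) {I : Type w} (N : Option I → Type w)
    [∀ v, L.Structure (N v)] (par : I → Option I) (f : ∀ i, N (par i) ↪[L] N (some i))
    (hf : ∀ i, K.IsStrongEmb (f i)) (hN : K.Mem (N none)) (ht : Option I → ℕ)
    (hht : ∀ i, ht (par i) < ht (some i)) :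
    ∃ (P : Type w) (_ : L.Structure P) (g : ∀ v, N v ↪[L] P),
      (∀ v, K.IsStrongEmb (g v)) ∧ ∀ i, (g (some i)).comp (f i) = g (par i) := by
  classical
  -- `Y` is large enough for one more node always to fit: it bounds the number of nodes, the size of
  -- each model and `K.LS`.
  let Y : Type w := (Option I ⊕ Σ v, N v) ⊕ K.LS.out
  have hI : #(Option I) ≤ #Y := mk_le_of_injective
    (Sum.inl_injective.comp Sum.inl_injective)
  have hNY : ∀ v, #(N v) ≤ #Y := fun v => mk_le_of_injective
    (Sum.inl_injective.comp (Sum.inr_injective.comp (sigma_mk_injective (i := v))))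
  have hLS : K.LS ≤ #Y := by
    rw [← mk_out K.LS]
    exact mk_le_of_injective Sum.inr_injective
  have hne : Nonempty (PartialCocone K N par f Y) := by
    obtain ⟨ρ⟩ : Nonempty (N none ↪ Y) := hNY none
    let ψ : N none → Option I × Y := fun x => (none, ρ x)
    have hψ : Function.Injective ψ := fun x y h => ρ.injective (Prod.ext_iff.1 h).2
    obtain ⟨str, E, hE⟩ := exists_structure_range (L := L) hψ
    have : Nonempty Y := by
      have : #Y ≠ 0 := (aleph0_pos.trans_le (isLSBound_of_le hLS).1).ne'
      exact mk_ne_zero_iff.1 this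
    let g : ∀ v, N v → Option I × Y :=
      Function.update (fun v _ => Classical.arbitrary (Option I × Y)) none ψ
    have hg : g none = ψ := Function.update_self _ _ _
    exact ⟨{ J := {none}, S := Set.range ψ, g := g, none_mem := rfl
             par_mem := fun i hi => by simp at hi
             fst_mem := by rintro _ ⟨x, rfl⟩; rfl
             strong := by
               rintro v rfl
               refine ⟨E.toEmbedding, isStrongEmb_equiv E hN, fun x => ?_⟩
               rw [hg]
               exact hE x
             compat := fun i hi => by simp at hi }⟩
  obtain ⟨m, hm⟩ := exists_maximal_of_nonempty_chains_bounded
    (r := PartialCocone.Le (K := K) (N := N) (par := par) (f := f) (Y := Y))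
    PartialCocone.exists_le_of_chain PartialCocone.Le.trans
  -- A maximal cocone covers every node, by induction on height: once the parent is covered, the
  -- node could be added.
  have hall : ∀ n, ∀ v, ht v = n → v ∈ m.J := by
    intro n
    induction n using Nat.strong_induction_on with
    | _ n ih =>
      rintro (_ | i) hv
      · exact m.none_mem
      · by_contra hi
        obtain ⟨q, hq, hiq⟩ := m.exists_le_insert hAP hf hI hNY hLS i hi
          (ih _ (hv ▸ hht i) _ rfl)
        exact hi ((hm q hq).1 hiq)
  have hall' : ∀ v, v ∈ m.J := fun v => hall _ v rfl
  choose e he hev using fun v => m.strong v (hall' v)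
  refine ⟨m.S, inferInstance, e, he, fun i => ?_⟩
  ext x : 1
  apply Subtype.ext
  rw [Embedding.comp_apply, hev, hev, m.compat i (hall' _)]

end Tree

/-! ### Galois types and their restrictions -/

section Types

variable {M : Type w} [L.Structure M]

theorem Pointed.Rel.refl (p : K.Pointed M) : p.Rel p :=
  ⟨p.N, p.str, Embedding.refl L _, Embedding.refl L _, isStrongEmb_refl p.strong.mem_cod,
    isStrongEmb_refl p.strong.mem_cod, rfl, rfl⟩

theorem Pointed.Rel.symm {p q : K.Pointed M} (h : p.Rel q) : q.Rel p := by
  obtain ⟨P, _, g, h, hg, hh, hc, ha⟩ := h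
  exact ⟨P, inferInstance, h, g, hh, hg, hc.symm, ha.symm⟩

theorem Pointed.Rel.trans (hAP : K.Amalgamation) {p q r : K.Pointed M} (h : p.Rel q)
    (h' : q.Rel r) : p.Rel r := by
  obtain ⟨P, _, g, h, hg, hh, hc, ha⟩ := h
  obtain ⟨P', _, g', h', hg', hh', hc', ha'⟩ := h'
  obtain ⟨Q, _, k, k', hk, hk', hkk⟩ := hAP _ _ _ h g' hh hg'
  have hkk' : ∀ x, k (h x) = k' (g' x) := DFunLike.congr_fun hkk
  refine ⟨Q, inferInstance, k.comp g, k'.comp h', hk.comp hg, hk'.comp hh', ?_, ?_⟩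
  · ext x
    change k (g (p.emb x)) = k' (h' (r.emb x))
    have h1 : g (p.emb x) = h (q.emb x) := DFunLike.congr_fun hc x
    have h2 : g' (q.emb x) = h' (r.emb x) := DFunLike.congr_fun hc' x
    rw [h1, ← h2, hkk']
  · change k (g p.a) = k' (h' r.a)
    rw [ha, ← ha', hkk']

theorem Pointed.rel_of_mk_eq (hAP : K.Amalgamation) {p q : K.Pointed M}
    (h : (Quot.mk _ p : K.GaType M) = Quot.mk _ q) : p.Rel q := by
  have := Quot.eqvGen_exact h
  clear h
  induction this with
  | rel _ _ h => exact h
  | refl p => exact Pointed.Rel.refl p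
  | symm _ _ _ ih => exact ih.symm
  | trans _ _ _ _ _ ih1 ih2 => exact ih1.trans hAP ih2

theorem GaType.restrict_restrict {M₀ M₁ : Type w} [L.Structure M₀] [L.Structure M₁]
    (f : M₁ ↪[L] M) (hf : K.IsStrongEmb f) (g : M₀ ↪[L] M₁) (hg : K.IsStrongEmb g)
    (q : K.GaType M) : (q.restrict f hf).restrict g hg = q.restrict (f.comp g) (hf.comp hg) := by
  induction q using Quot.ind
  rfl

theorem GaType.restrictTo_restrictTo {S T : L.Substructure M} (hS : K.Strong M S)
    (hT : K.Strong M T) (h : S ≤ T) (q : K.GaType M) :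
    (q.restrictTo T hT).restrict (Substructure.inclusion h)
      ((isStrongEmb_subtype hS).codRestrict hT fun x => h x.2) = q.restrictTo S hS :=
  GaType.restrict_restrict _ _ _ _ _

variable (K) in
/-- The type over `M` of an element of `M`. -/
def GaType.realized (hM : K.Mem M) (a : M) : K.GaType M :=
  Quot.mk _ ⟨M, Embedding.refl L M, isStrongEmb_refl hM, a⟩

theorem GaType.realized_injective (hM : K.Mem M) :
    Function.Injective (GaType.realized K hM) := by
  intro a b hab
  -- Which element of `M`, if any, the distinguished point equals is an invariant of the type.
  let F : K.GaType M → (M → Prop) := Quot.lift (fun p x => p.a = p.emb x) (by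
    rintro p q ⟨P, _, g, h, hg, hh, hc, ha⟩
    funext x
    have hx : g (p.emb x) = h (q.emb x) := DFunLike.congr_fun hc x
    apply propext
    rw [← g.injective.eq_iff, ha, hx, h.injective.eq_iff])
  have h1 : F (GaType.realized K hM a) a := rfl
  rw [hab] at h1
  exact h1.symm

/-- This is the lower bound in `Stable`, which asks for an exact number of types. -/
theorem lift_mk_le_mk_gaType (hM : K.Mem M) :
    Cardinal.lift.{max u v (w + 1)} #M ≤ #(K.GaType M) := by
  have := lift_mk_le_lift_mk_of_injective (GaType.realized_injective (K := K) hM)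
  rw [← lift_id'.{w, max u v (w + 1)} #(K.GaType M)]
  exact this

end Types

/-! ### Limits of `ω`-sequences of models and types -/

section Sequences

variable {M : ℕ → Type w} [∀ n, L.Structure (M n)]

theorem natLERec_self (f : ∀ n, M n ↪[L] M (n + 1)) (n : ℕ) :
    Language.DirectedSystem.natLERec f n n le_rfl = Embedding.refl L _ := by
  ext x
  simp [Nat.leRecOn_self]

theorem natLERec_succ (f : ∀ n, M n ↪[L] M (n + 1)) {m n : ℕ} (h : m ≤ n) :
    Language.DirectedSystem.natLERec f m (n + 1) (h.trans n.le_succ) =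
      (f n).comp (Language.DirectedSystem.natLERec f m n h) := by
  ext x
  simp [Nat.leRecOn_succ h]

theorem natLERec_strong {f : ∀ n, M n ↪[L] M (n + 1)} (hf : ∀ n, K.IsStrongEmb (f n))
    (m n : ℕ) (h : m ≤ n) : K.IsStrongEmb (Language.DirectedSystem.natLERec f m n h) := by
  induction n, h using Nat.le_induction with
  | base =>
    rw [natLERec_self]
    exact isStrongEmb_refl (hf m).mem_dom
  | succ n h ih =>
    rw [natLERec_succ f h]
    exact (hf n).comp ih

theorem natLERec_compat {f : ∀ n, M n ↪[L] M (n + 1)} {P : Type w} [L.Structure P]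
    {g : ∀ n, M n ↪[L] P} (hgf : ∀ n x, g (n + 1) (f n x) = g n x) (m n : ℕ) (h : m ≤ n) (x : M m) :
    g n (Language.DirectedSystem.natLERec f m n h x) = g m x := by
  induction n, h using Nat.le_induction with
  | base =>
    rw [natLERec_self]
    rfl
  | succ n h ih => rw [natLERec_succ f h, Embedding.comp_apply, hgf, ih]

/-- An `ω`-sequence of models has a limit, which is embedded strongly in each cocone. -/
theorem exists_limit_nat (f : ∀ n, M n ↪[L] M (n + 1)) (hf : ∀ n, K.IsStrongEmb (f n)) :
    ∃ (D : Type w) (_ : L.Structure D) (i : ∀ n, M n ↪[L] D), (∀ n, K.IsStrongEmb (i n)) ∧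
      (∀ n x, i (n + 1) (f n x) = i n x) ∧
      ∀ (P : Type w) [L.Structure P] (g : ∀ n, M n ↪[L] P), (∀ n, K.IsStrongEmb (g n)) →
        (∀ n x, g (n + 1) (f n x) = g n x) →
        ∃ k : D ↪[L] P, K.IsStrongEmb k ∧ ∀ n x, k (i n x) = g n x := by
  let G : ULift.{w} ℕ → Type w := fun n => M n.down
  let F : ∀ i j : ULift.{w} ℕ, i ≤ j → G i ↪[L] G j :=
    fun i j h => Language.DirectedSystem.natLERec f i.down j.down h
  have : DirectedSystem G fun i j h => F i j h :=
    ⟨fun i x => (Language.DirectedSystem.natLERec.directedSystem f).1 x,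
      fun i j k h h' x => (Language.DirectedSystem.natLERec.directedSystem f).2 h h' x⟩
  have htot : ∀ i j : ULift.{w} ℕ, i ≤ j ∨ j ≤ i := fun i j => le_total i.down j.down
  have hF : ∀ i j h, K.IsStrongEmb (F i j h) := fun i j h => natLERec_strong hf _ _ h
  obtain ⟨hDm, hDs⟩ := directLimit_strong (K := K) F htot hF
  refine ⟨Language.DirectLimit G F, inferInstance,
    fun n => Language.DirectLimit.of L _ G F ⟨n⟩, fun n => hDs ⟨n⟩, fun n x => ?_, ?_⟩
  · have h : (⟨n⟩ : ULift.{w} ℕ) ≤ ⟨n + 1⟩ := n.le_succ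
    have h1 : F ⟨n⟩ ⟨n + 1⟩ h x = f n x := by
      change Language.DirectedSystem.natLERec f n (n + 1) _ x = f n x
      rw [natLERec_succ f le_rfl, natLERec_self]
      rfl
    rw [← h1]
    exact Language.DirectLimit.of_f
  · intro P _ g hg hgf
    exact ⟨_, directLimit_lift_strong F htot hF (fun i => g i.down) (fun i => hg _)
      (fun i j h x => natLERec_compat hgf _ _ h x),
      fun n x => Language.DirectLimit.lift_of (G := G) (f := F)
        (i := (⟨n⟩ : ULift.{w} ℕ)) (fun i => g i.down) _ x⟩

/-- An increasing `ω`-sequence of Galois types has an extension to each model that extends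
the sequence of their domains. -/
theorem exists_gaType_of_seq (hAP : K.Amalgamation) (f : ∀ n, M n ↪[L] M (n + 1))
    (hf : ∀ n, K.IsStrongEmb (f n)) (q : ∀ n, K.GaType (M n))
    (hq : ∀ n, (q (n + 1)).restrict (f n) (hf n) = q n)
    {P : Type w} [L.Structure P] (g : ∀ n, M n ↪[L] P) (hg : ∀ n, K.IsStrongEmb (g n))
    (hgf : ∀ n, (g (n + 1)).comp (f n) = g n) :
    ∃ r : K.GaType P, ∀ n, r.restrict (g n) (hg n) = q n := by
  -- A representative of `q n` embeds into one of `q (n + 1)`, with the distinguished point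
  -- preserved. This makes the representatives an `ω`-sequence of models with limit `E`.
  have step : ∀ n (p : {p : K.Pointed (M n) // Quot.mk _ p = q n}),
      ∃ (p' : {p : K.Pointed (M (n + 1)) // Quot.mk _ p = q (n + 1)}) (k : p.1.N ↪[L] p'.1.N),
        K.IsStrongEmb k ∧ (∀ x, k (p.1.emb x) = p'.1.emb (f n x)) ∧ k p.1.a = p'.1.a := by
    rintro n ⟨p, hp⟩
    obtain ⟨p₁, hp₁⟩ := Quot.exists_rep (q (n + 1))
    have h1 := hq n
    rw [← hp₁, ← hp] at h1
    obtain ⟨Q, _, k, h, hk, hh, hc, ha⟩ := (Pointed.rel_of_mk_eq hAP h1).symm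
    refine ⟨⟨⟨Q, h.comp p₁.emb, hh.comp p₁.strong, h p₁.a⟩, ?_⟩, k, hk, ?_, ha⟩
    · rw [← hp₁]
      exact Quot.sound ⟨Q, inferInstance, Embedding.refl L _, h, isStrongEmb_refl hh.mem_cod, hh,
        rfl, rfl⟩
    · intro x
      exact DFunLike.congr_fun hc x
  choose nxt k hk hkc hka using step
  have p0 : {p : K.Pointed (M 0) // Quot.mk _ p = q 0} :=
    ⟨(Quot.exists_rep (q 0)).choose, (Quot.exists_rep (q 0)).choose_spec⟩
  let p : ∀ n, {p : K.Pointed (M n) // Quot.mk _ p = q n} := fun n => Nat.rec p0 nxt n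
  have hps : ∀ n, p (n + 1) = nxt n (p n) := fun n => rfl
  let N : ℕ → Type w := fun n => (p n).1.N
  let κ : ∀ n, N n ↪[L] N (n + 1) := fun n => k n (p n)
  have hκ : ∀ n, K.IsStrongEmb (κ n) := fun n => hk n (p n)
  obtain ⟨D, _, i, hi, hif, hiu⟩ := exists_limit_nat (K := K) f hf
  obtain ⟨E, _, j, hj, hjf, hju⟩ := exists_limit_nat (K := K) κ hκ
  obtain ⟨φ, hφ, hφi⟩ := hiu P g hg (fun n x => DFunLike.congr_fun (hgf n) x)
  obtain ⟨ψ, hψ, hψi⟩ := hiu E (fun n => (j n).comp (p n).1.emb)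
    (fun n => (hj n).comp (p n).1.strong) (fun n x => by
      change j (n + 1) ((p (n + 1)).1.emb (f n x)) = j n ((p n).1.emb x)
      rw [← hjf n]
      exact congrArg (j (n + 1)) (hkc n (p n) x).symm)
  have hja : ∀ n, j n (p n).1.a = j 0 (p 0).1.a := by
    intro n
    induction n with
    | zero => rfl
    | succ n ih =>
      rw [← ih, ← hjf n]
      exact congrArg (j (n + 1)) (hka n (p n)).symm
  -- The limit `D` of the `M n` embeds strongly in both `P` and `E`. Amalgamation over `D` puts the
  -- common distinguished point into an extension of `P`.
  obtain ⟨Q, _, s, t, hs, ht, hst⟩ := hAP _ _ _ φ ψ hφ hψ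
  refine ⟨Quot.mk _ ⟨Q, s, hs, t (j 0 (p 0).1.a)⟩, fun n => ?_⟩
  rw [← (p n).2]
  refine Quot.sound ⟨Q, inferInstance, Embedding.refl L _, t.comp (j n),
    isStrongEmb_refl hs.mem_cod, ht.comp (hj n), ?_, ?_⟩
  · ext x
    change s (g n x) = t (j n ((p n).1.emb x))
    rw [← hφi]
    have h1 : ψ (i n x) = j n ((p n).1.emb x) := hψi n x
    rw [← h1]
    exact DFunLike.congr_fun hst (i n x)
  · change t (j 0 (p 0).1.a) = t (j n (p n).1.a)
    rw [hja n]

end Sequences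

/-! ### The rank and types of rank `∞` -/

section Rank

variable {lam : Cardinal.{w}} {M : Type w} [L.Structure M]

theorem smallRankGE_zero (q : K.GaType M) : K.SmallRankGE lam 0 M q := by
  unfold SmallRankGE
  rw [Ordinal.limitRecOn_zero]
  trivial

theorem smallRankGE_add_one {α : Ordinal.{max u v (w + 1)}} {q : K.GaType M} :
    K.SmallRankGE lam (α + 1) M q ↔
      ∃ (M' : Type w) (_ : L.Structure M') (f : M ↪[L] M') (hf : K.IsStrongEmb f),
        Cardinal.lift.{max u v (w + 1)} lam <
          #{q' : K.GaType M' // q'.restrict f hf = q ∧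
            ∀ (N : L.Substructure M') (hN : K.Strong M' N), #N ≤ lam →
              K.SmallRankGE lam α N (q'.restrictTo N hN)} := by
  unfold SmallRankGE
  rw [Ordinal.limitRecOn_add_one]

theorem smallRankGE_limit {α : Ordinal.{max u v (w + 1)}} (hα : Order.IsSuccLimit α)
    {q : K.GaType M} : K.SmallRankGE lam α M q ↔ ∀ β < α, K.SmallRankGE lam β M q := by
  unfold SmallRankGE
  rw [Ordinal.limitRecOn_limit _ _ _ _ hα]

theorem smallRankGE_add_one_mono {α β : Ordinal.{max u v (w + 1)}}
    (h : ∀ (N : Type w) [L.Structure N] (q : K.GaType N), K.SmallRankGE lam α N q →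
      K.SmallRankGE lam β N q) {q : K.GaType M} (hq : K.SmallRankGE lam (α + 1) M q) :
    K.SmallRankGE lam (β + 1) M q := by
  obtain ⟨M', _, f, hf, hlt⟩ := smallRankGE_add_one.1 hq
  refine smallRankGE_add_one.2 ⟨M', inferInstance, f, hf, hlt.trans_le ?_⟩
  exact mk_subtype_mono fun q' hq' => ⟨hq'.1, fun N hN hc => h N _ (hq'.2 N hN hc)⟩

/-- The successor clause speaks of extensions of `q` and not of `q`, so even the descent from `γ +
1` to `γ` needs induction: the condition on the extensions is weakened first, by the induction
hypothesis. -/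
theorem SmallRankGE.mono {α β : Ordinal.{max u v (w + 1)}} (hβα : β ≤ α) {q : K.GaType M}
    (hq : K.SmallRankGE lam α M q) : K.SmallRankGE lam β M q := by
  suffices H : ∀ α : Ordinal.{max u v (w + 1)}, ∀ β < α, ∀ (N : Type w) [L.Structure N]
      (q : K.GaType N), K.SmallRankGE lam α N q → K.SmallRankGE lam β N q by
    rcases hβα.lt_or_eq with h | rfl
    · exact H α β h M q hq
    · exact hq
  intro α
  induction α using WellFoundedLT.induction with
  | ind α ih =>
  intro β hβ N _ q hq
  rcases Ordinal.zero_or_succ_or_isSuccLimit α with rfl | ⟨γ, rfl⟩ | hlim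
  · exact absurd hβ not_lt_zero
  · have hγ : γ < Order.succ γ := Order.lt_succ γ
    have hγq : K.SmallRankGE lam γ N q := by
      rw [Order.succ_eq_add_one] at hq
      rcases Ordinal.zero_or_succ_or_isSuccLimit γ with rfl | ⟨δ, rfl⟩ | hlim
      · exact smallRankGE_zero q
      · have := smallRankGE_add_one_mono (β := δ)
          (fun N _ q h => ih (Order.succ δ) hγ δ (Order.lt_succ δ) N q h) hq
        rwa [← Order.succ_eq_add_one] at this
      · rw [smallRankGE_limit hlim]
        intro δ hδ
        have h1 := smallRankGE_add_one_mono (β := δ) (fun N _ q h => ih γ hγ δ hδ N q h) hq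
        rw [← Order.succ_eq_add_one] at h1
        exact ih _ ((hlim.succ_lt hδ).trans hγ) δ (Order.lt_succ δ) N q h1
    rcases (Order.lt_succ_iff.1 hβ).lt_or_eq with h | rfl
    · exact ih γ hγ β h N q hγq
    · exact hγq
  · exact (smallRankGE_limit hlim).1 hq β hβ

variable (K lam) in
/-- There is an ordinal that no ordinal valued rank exceeds. -/
theorem exists_rank_bound : ∃ α : Ordinal.{max u v (w + 1)}, ∀ (M : Type w) [L.Structure M]
    (q : K.GaType M), K.SmallRankGE lam α M q → ∀ β, K.SmallRankGE lam β M q := by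
  classical
  -- All types over all structures form a type in the universe of the ordinals used for the rank.
  -- Hence there is a supremum of one failing ordinal for each of them.
  let A : Type max u v (w + 1) := Σ (M : Type w) (_ : L.Structure M), K.GaType M
  let F : A → Ordinal.{max u v (w + 1)} := fun x =>
    letI := x.2.1
    if h : ∃ α, ¬ K.SmallRankGE lam α x.1 x.2.2 then h.choose else 0
  refine ⟨⨆ x, F x, fun M str q hq β => ?_⟩
  by_contra hβ
  have h : ∃ α, ¬ K.SmallRankGE lam α M q := ⟨β, hβ⟩
  have h1 : F ⟨M, str, q⟩ = h.choose := dif_pos h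
  have h2 : F ⟨M, str, q⟩ ≤ ⨆ x, F x := Ordinal.le_iSup F _
  rw [h1] at h2
  exact h.choose_spec (hq.mono h2)

variable (K lam) in
/-- A Galois type of rank `∞` over a model of cardinality at most `lam`. -/
structure UnrankedType where
  M : Type w
  [str : L.Structure M]
  q : K.GaType M
  card_le : #M ≤ lam
  rank : ∀ α, K.SmallRankGE lam α M q

attribute [instance] UnrankedType.str

/-- A type of rank `∞` has `lam` extensions of rank `∞` over some model of
cardinality at most `lam`. -/
theorem UnrankedType.exists_split (n : UnrankedType K lam) {χ : Cardinal.{w}} (htame : K.Tame χ)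
    (hχ : χ ≤ lam) (hLS : K.LS ≤ lam) (Λ : Type w) (hΛ : #Λ ≤ lam) :
    ∃ (M' : Type w) (_ : L.Structure M') (f : n.M ↪[L] M') (hf : K.IsStrongEmb f)
      (q : Λ → K.GaType M'), #M' ≤ lam ∧ Function.Injective q ∧
        ∀ i, (q i).restrict f hf = n.q ∧ ∀ α, K.SmallRankGE lam α M' (q i) := by
  classical
  have hω : ℵ₀ ≤ lam := (isLSBound_of_le hLS).1
  -- Rank at least `α` means rank `∞`, so rank at least `α + 1` produces extensions whose small
  -- restrictions have rank `∞`.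
  obtain ⟨α, hα⟩ := exists_rank_bound K lam
  obtain ⟨M', _, f, hf, hlt⟩ := smallRankGE_add_one.1 (n.rank (α + 1))
  have hle : Cardinal.lift.{max u v (w + 1)} #Λ ≤ Cardinal.lift.{w} #_ :=
    (lift_le.2 hΛ).trans (hlt.le.trans_eq (lift_id'.{w, max u v (w + 1)} _).symm)
  obtain ⟨ρ⟩ := lift_mk_le'.1 hle
  have hsep : ∀ i j : Λ, ∃ A : Set M', #A ≤ lam ∧ (i ≠ j → ∀ (T : L.Substructure M')
      (hT : K.Strong M' T), A ⊆ T → (ρ i).1.restrictTo T hT ≠ (ρ j).1.restrictTo T hT) := by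
    intro i j
    by_cases hij : i = j
    · exact ⟨∅, by simp, fun h => absurd hij h⟩
    · have hne : (ρ i).1 ≠ (ρ j).1 := fun h => hij (ρ.injective (Subtype.ext h))
      obtain ⟨S, hS, h1, h2⟩ := htame M' hf.mem_cod _ _ hne
      refine ⟨S, h1.trans hχ, fun _ T hT hST h => h2 ?_⟩
      rw [← GaType.restrictTo_restrictTo hS hT hST, h, GaType.restrictTo_restrictTo hS hT hST]
  choose A hA hAne using hsep
  -- `T` contains the separating submodels of all pairs, so the restrictions to `T` stay distinct.
  -- Being of size at most `lam`, it is also one of the submodels at which the rank is measured.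
  obtain ⟨T, hT, hAT, hTc⟩ := exists_strong_superset hLS hf.mem_cod
    (Set.range f ∪ ⋃ p : Λ × Λ, A p.1 p.2) (by
      refine (mk_union_le _ _).trans (add_le_of_le hω (mk_range_le.trans n.card_le) ?_)
      refine (mk_iUnion_le_sum_mk).trans ((sum_le_sum _ (fun _ => lam)
        (fun p : Λ × Λ => hA p.1 p.2)).trans ?_)
      rw [sum_const', mk_prod, lift_id]
      exact mul_le_of_le hω (mul_le_of_le hω hΛ hΛ) le_rfl)
  have hfT : ∀ x, f x ∈ T := fun x => hAT (Or.inl ⟨x, rfl⟩)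
  refine ⟨T, inferInstance, f.codRestrict T hfT, hf.codRestrict hT hfT,
    fun i => (ρ i).1.restrictTo T hT, hTc, fun i j hij => ?_, fun i => ⟨?_, ?_⟩⟩
  · by_contra hne
    exact hAne i j hne T hT (fun x hx => hAT (Or.inr (Set.mem_iUnion.2 ⟨(i, j), hx⟩))) hij
  · exact (GaType.restrict_restrict _ _ _ _ _).trans (ρ i).2.1
  · exact hα T _ ((ρ i).2.2 T hT hTc)

end Rank

/-! ### From stability to total transcendence -/

section Stability

/-- Trees of models that are indexed by finite sequences can be amalgamated. -/
theorem exists_list_amalgam (hAP : K.Amalgamation) {Λ : Type w} (T : List Λ → Type w)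
    [∀ s, L.Structure (T s)] (f : ∀ a s, T s ↪[L] T (a :: s)) (hf : ∀ a s, K.IsStrongEmb (f a s))
    (hT : K.Mem (T [])) :
    ∃ (P : Type w) (_ : L.Structure P) (g : ∀ s, T s ↪[L] P),
      (∀ s, K.IsStrongEmb (g s)) ∧ ∀ a s, (g (a :: s)).comp (f a s) = g s := by
  -- Lists are recoded with `none` as the root `[]` and `some (a, t)` as `a :: t`. Parents are tails
  -- and the height is the length.
  let toList : Option (Λ × List Λ) → List Λ := fun v => v.elim [] fun p => p.1 :: p.2
  let par : Λ × List Λ → Option (Λ × List Λ)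
    | (_, []) => none
    | (_, b :: t) => some (b, t)
  let F : ∀ i : Λ × List Λ, T (toList (par i)) ↪[L] T (toList (some i))
    | (a, []) => f a []
    | (a, b :: t) => f a (b :: t)
  obtain ⟨P, str, g, hg, hgF⟩ := exists_tree_amalgam hAP (fun v => T (toList v)) par F
    (by
      rintro ⟨a, _ | ⟨b, t⟩⟩
      · exact hf a []
      · exact hf a (b :: t)) hT
    (fun v => (toList v).length) (by
      rintro ⟨a, _ | ⟨b, t⟩⟩
      · exact Nat.zero_lt_one
      · exact Nat.lt_succ_self _)
  let G : ∀ s, T s ↪[L] P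
    | [] => g none
    | a :: t => g (some (a, t))
  refine ⟨P, str, G, ?_, ?_⟩
  · rintro (_ | ⟨a, t⟩)
    · exact hg none
    · exact hg (some (a, t))
  · rintro a (_ | ⟨b, t⟩)
    · exact hgF (a, [])
    · exact hgF (a, b :: t)

/-- Distinct types over a model can be realized by distinct elements of one model. -/
theorem exists_card_le_of_injective (hAP : K.Amalgamation) {M : Type w} [L.Structure M]
    (hM : K.Mem M) {Λ : Type w} (q : Λ → K.GaType M) (hq : Function.Injective q) :
    ∃ (P : Type w) (_ : L.Structure P), K.Mem P ∧ #Λ ≤ #P := by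
  choose p hp using fun i => Quot.exists_rep (q i)
  let N : Option Λ → Type w := fun v => v.elim M fun i => (p i).N
  let str : ∀ v, L.Structure (N v) := fun v =>
    Option.rec (motive := fun v => L.Structure (N v)) ‹L.Structure M› (fun i => (p i).str) v
  -- The tree has height one: `M` is the root, and the models that realize the types are its
  -- children.
  obtain ⟨P, _, g, hg, hgf⟩ := exists_tree_amalgam (K := K) hAP N (fun _ => none)
    (fun i => (p i).emb) (fun i => (p i).strong) hM (fun v => v.elim 0 fun _ => 1)
    (fun _ => Nat.zero_lt_one)
  let e : ∀ i, (p i).N ↪[L] P := fun i => g (some i)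
  have he : ∀ i, K.IsStrongEmb (e i) := fun i => hg (some i)
  refine ⟨P, inferInstance, (hg none).mem_cod,
    mk_le_of_injective (f := fun i => e i (p i).a) fun i j hij => hq ?_⟩
  rw [← hp i, ← hp j]
  exact Quot.sound ⟨P, inferInstance, e i, e j, he i, he j, (hgf i).trans (hgf j).symm, hij⟩

/-- A type of rank `∞` grows a `lam`-branching tree of types of height `ω`. Over an amalgam of size
`lam` its branches give `lam ^ ℵ₀` types. -/
theorem totallyTranscendental_of_stable (hJEP : K.JointEmbedding) (hAP : K.Amalgamation)
    {χ lam : Cardinal.{w}} (htame : K.Tame χ) (hχ : χ ≤ lam) (hLS : K.LS ≤ lam)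
    (hpow : lam < lam ^ ℵ₀) (hstable : K.Stable lam) : K.TotallyTranscendental lam := by
  intro M _ hM q
  by_contra! hq
  have hω : ℵ₀ ≤ lam := (isLSBound_of_le hLS).1
  obtain ⟨S₀, hS₀, -, hS₀c⟩ := exists_strong_superset hLS hM ∅ (by simp)
  let n₀ : UnrankedType K lam := ⟨S₀, q.restrictTo S₀ hS₀, hS₀c, fun α => hq α S₀ hS₀ hS₀c⟩
  let Λ : Type w := lam.out
  have hΛ : #Λ = lam := mk_out lam
  choose E str F hF p hEc hpi hp using fun n : UnrankedType K lam =>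
    n.exists_split htame hχ hLS Λ hΛ.le
  let child : UnrankedType K lam → Λ → UnrankedType K lam := fun n a =>
    ⟨E n, p n a, hEc n, (hp n a).2⟩
  let node : List Λ → UnrankedType K lam := fun s => s.rec n₀ fun a _ n => child n a
  obtain ⟨P, _, g, hg, hgf⟩ := exists_list_amalgam (K := K) hAP (fun s => E (node s))
    (fun a s => F (node (a :: s))) (fun a s => hF (node (a :: s))) (hF n₀).mem_cod
  -- Stability concerns models of size exactly `lam`, while the models of the tree might be smaller.
  -- A model `Q` with at least `lam` elements, jointly embedded with `P`, allows padding by a set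
  -- `B` of size `lam`.
  obtain ⟨Q, _, hQ, hQc⟩ := exists_card_le_of_injective hAP (hF n₀).mem_cod _ (hpi n₀)
  obtain ⟨R, _, k, l, hk, hl⟩ := hJEP P Q (hg []).mem_cod hQ
  have hRc : lam ≤ #R := by
    rw [← hΛ]
    exact hQc.trans (mk_le_of_injective l.injective)
  obtain ⟨B, hB⟩ := le_mk_iff_exists_set.1 hRc
  have : Infinite Λ := infinite_iff.2 (hω.trans_eq hΛ.symm)
  obtain ⟨S, hS, hAS, hSc⟩ := exists_strong_superset hLS hk.mem_cod
    (B ∪ ⋃ s : List Λ, Set.range (k.comp (g s))) (by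
      refine (mk_union_le _ _).trans (add_le_of_le hω hB.le ?_)
      refine mk_iUnion_le_sum_mk.trans ((sum_le_sum _ (fun _ => lam)
        (fun s => mk_range_le.trans (hEc _))).trans ?_)
      rw [sum_const', mk_list_eq_mk, hΛ]
      exact (mul_eq_self hω).le)
  have hScard : #S = lam := by
    refine le_antisymm hSc ?_
    rw [← hB]
    exact mk_le_mk_of_subset (Set.subset_union_left.trans hAS)
  have hmem : ∀ s x, k.comp (g s) x ∈ S := fun s x =>
    hAS (Or.inr (Set.mem_iUnion.2 ⟨s, x, rfl⟩))
  let G : ∀ s, E (node s) ↪[L] S := fun s => (k.comp (g s)).codRestrict S (hmem s)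
  have hG : ∀ s, K.IsStrongEmb (G s) := fun s => (hk.comp (hg s)).codRestrict hS (hmem s)
  have hGf : ∀ a s, (G (a :: s)).comp (F (node (a :: s))) = G s := by
    intro a s
    ext x : 1
    apply Subtype.ext
    exact congrArg k (DFunLike.congr_fun (hgf a s) x)
  -- The first `n` values of `η`, the latest at the head, so that one step along the branch is a
  -- `cons`.
  let seq : (ℕ → Λ) → ℕ → List Λ := fun η n => n.rec [] fun n s => η n :: s
  have hr : ∀ η : ℕ → Λ, ∃ r : K.GaType S,
      ∀ n, r.restrict (G (seq η n)) (hG _) = p (node (seq η n)) (η n) := by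
    intro η
    refine exists_gaType_of_seq hAP (fun n => F (node (seq η (n + 1))))
      (fun n => hF (node (seq η (n + 1)))) (fun n => p (node (seq η n)) (η n)) (fun n => ?_)
      (fun n => G (seq η n)) (fun n => hG _) (fun n => hGf _ _)
    exact (hp (node (seq η (n + 1))) (η (n + 1))).1
  choose r hr using hr
  have hinj : Function.Injective r := by
    intro η θ h
    -- Branches that agree below `n` pass through the same node, where different values pick
    -- different types.
    have key : ∀ n, seq η n = seq θ n → η n = θ n := by
      intro n hn
      have h1 := hr η n
      have h2 := hr θ n
      rw [← hn, ← h, h1] at h2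
      exact hpi _ h2
    have hseq : ∀ n, seq η n = seq θ n := by
      intro n
      induction n with
      | zero => rfl
      | succ n ih =>
        change η n :: seq η n = θ n :: seq θ n
        rw [ih, key n ih]
    funext n
    exact key n (hseq n)
  have h1 := lift_mk_le_lift_mk_of_injective hinj
  rw [hstable S (K.isAEC.mem_left _ _ hS) hScard, lift_lift, mk_pi, prod_const] at h1
  have h2 : Cardinal.lift.{max u v (w + 1)} (lam ^ ℵ₀) ≤ Cardinal.lift.{max u v (w + 1)} lam := by
    simpa [hΛ] using h1
  exact hpow.not_ge (lift_le.1 h2)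

end Stability

/-! ### Counting types -/

section Counting

/-- The diagram of a structure, the elements of which are named by the elements of `Z`. -/
def diagram {N Z : Type w} [L.Structure N] (j : N → Z) : Set (L.Symbols × List Z) :=
  {s | match s.1 with
    | Sum.inl F => ∃ x : Fin F.1 → N,
        s.2 = j (Structure.funMap F.2 x) :: List.ofFn (fun i => j (x i))
    | Sum.inr R => ∃ x : Fin R.1 → N, Structure.RelMap R.2 x ∧ s.2 = List.ofFn (fun i => j (x i))}

theorem mem_diagram_fun {N Z : Type w} [L.Structure N] {j : N → Z} (hj : Function.Injective j)
    {n : ℕ} (F : L.Functions n) (x : Fin n → N) (y : N) :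
    ((Sum.inl ⟨n, F⟩, j y :: List.ofFn (fun i => j (x i))) : L.Symbols × List Z) ∈ diagram j ↔
      y = Structure.funMap F x := by
  constructor
  · rintro ⟨x', h⟩
    obtain ⟨h1, h2⟩ := List.cons_eq_cons.1 h
    have hx : x = x' := funext fun i => hj (congrFun (List.ofFn_injective h2) i)
    rw [hx]
    exact hj h1
  · rintro rfl
    exact ⟨x, rfl⟩

theorem mem_diagram_rel {N Z : Type w} [L.Structure N] {j : N → Z} (hj : Function.Injective j)
    {n : ℕ} (R : L.Relations n) (x : Fin n → N) :
    ((Sum.inr ⟨n, R⟩, List.ofFn (fun i => j (x i))) : L.Symbols × List Z) ∈ diagram j ↔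
      Structure.RelMap R x := by
  constructor
  · rintro ⟨x', h, h'⟩
    have hx : x = x' := funext fun i => hj (congrFun (List.ofFn_injective h') i)
    rwa [hx]
  · intro h
    exact ⟨x, h, rfl⟩

theorem exists_equiv_of_diagram_eq {N N' Z : Type w} [L.Structure N] [L.Structure N']
    {j : N → Z} {j' : N' → Z} (hj : Function.Injective j) (hj' : Function.Injective j')
    (hr : Set.range j = Set.range j') (hd : diagram (L := L) j = diagram j') :
    ∃ e : N ≃[L] N', ∀ x, j' (e x) = j x := by
  let E : N ≃ N' := (Equiv.ofInjective j hj).trans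
    ((Equiv.setCongr hr).trans (Equiv.ofInjective j' hj').symm)
  have hE : ∀ x, j' (E x) = j x := fun x => Equiv.apply_ofInjective_symm hj' _
  refine ⟨{ E with map_fun' := ?_, map_rel' := ?_ }, hE⟩
  · intro n F x
    have h1 := (mem_diagram_fun hj F x _).2 rfl
    rw [hd, ← hE] at h1
    simp only [← hE] at h1
    exact (mem_diagram_fun hj' F (fun i => E (x i)) _).1 h1
  · intro n R x
    have h1 := mem_diagram_rel (L := L) hj R x
    rw [hd] at h1
    simp only [← hE] at h1
    rw [← h1]
    exact (mem_diagram_rel hj' R (fun i => E (x i))).symm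

/-- A strong submodel that contains `M` and the distinguished point represents the same type. -/
theorem exists_small_rep {κ : Cardinal.{w}} (hLS : K.LS ≤ κ) {M : Type w} [L.Structure M]
    (hM : #M ≤ κ) (q : K.GaType M) : ∃ p : K.Pointed M, #p.N ≤ κ ∧ Quot.mk _ p = q := by
  obtain ⟨p, rfl⟩ := Quot.exists_rep q
  have hω := (isLSBound_of_le hLS).1
  obtain ⟨T, hT, hAT, hTc⟩ := exists_strong_superset hLS p.strong.mem_cod
    (Set.range p.emb ∪ {p.a}) ((mk_union_le _ _).trans
      (add_le_of_le hω (mk_range_le.trans hM) (by simpa using one_le_aleph0.trans hω)))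
  have hT' : ∀ x, p.emb x ∈ T := fun x => hAT (Or.inl ⟨x, rfl⟩)
  refine ⟨⟨T, p.emb.codRestrict T hT', p.strong.codRestrict hT hT', ⟨p.a, hAT (Or.inr rfl)⟩⟩,
    hTc, Quot.sound ?_⟩
  exact ⟨p.N, p.str, T.subtype, Embedding.refl L _, isStrongEmb_subtype hT,
    isStrongEmb_refl p.strong.mem_cod, rfl, rfl⟩

/-- A representative of size at most `κ`, with elements named in a set `Z` of size `κ`, is
determined up to isomorphism over `M` by its diagram, its set of names, the names of the elements of
`M` and that of the point. These are subsets of sets of size at most `κ`. -/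
theorem mk_gaType_le_two_power {κ : Cardinal.{w}} (hLS : K.LS ≤ κ)
    (hL : Cardinal.lift.{w} L.card ≤ Cardinal.lift.{max u v} κ) {M : Type w} [L.Structure M]
    (hM : #M ≤ κ) : #(K.GaType M) ≤ Cardinal.lift.{max u v (w + 1)} (2 ^ κ) := by
  have hω := (isLSBound_of_le hLS).1
  let Z : Type w := κ.out
  have hZ : #Z = κ := mk_out κ
  have hZω : Infinite Z := infinite_iff.2 (hω.trans_eq hZ.symm)
  choose p hpc hp using fun q : K.GaType M => exists_small_rep hLS hM q
  have hj : ∀ q, Nonempty ((p q).N ↪ Z) := fun q => (hpc q).trans_eq hZ.symm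
  let j : ∀ q, (p q).N ↪ Z := fun q => (hj q).some
  let code : K.GaType M → Set (L.Symbols × List Z) × Set (M × Z) × Set Z × Set Z := fun q =>
    (diagram (j q), {x | x.2 = j q ((p q).emb x.1)}, Set.range (j q), {j q (p q).a})
  have hinj : Function.Injective code := by
    intro q q' h
    obtain ⟨h1, h2⟩ := Prod.ext_iff.1 h
    obtain ⟨h2, h3⟩ := Prod.ext_iff.1 h2
    obtain ⟨h3, h4⟩ := Prod.ext_iff.1 h3
    obtain ⟨e, he⟩ := exists_equiv_of_diagram_eq (j q).injective (j q').injective h3 h1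
    rw [← hp q, ← hp q']
    refine Quot.sound ⟨(p q').N, inferInstance, e.toEmbedding, Embedding.refl L _,
      isStrongEmb_equiv e (p q).strong.mem_cod, isStrongEmb_refl (p q').strong.mem_cod, ?_, ?_⟩
    · ext x
      have h5 : (x, j q ((p q).emb x)) ∈ (code q').2.1 :=
        h2 ▸ (rfl : j q ((p q).emb x) = j q ((p q).emb x))
      apply (j q').injective
      exact (he _).trans h5
    · apply (j q').injective
      exact (he _).trans (Set.singleton_injective h4)
  have h2κ : ℵ₀ ≤ 2 ^ κ := hω.trans (cantor κ).le
  have hc1 : #(Set (L.Symbols × List Z)) ≤ Cardinal.lift.{max u v} (2 ^ κ) := by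
    rw [mk_set, lift_power, lift_two]
    refine power_le_power_left two_ne_zero ?_
    rw [mk_prod, mk_list_eq_mk, hZ]
    refine mul_le_of_le (aleph0_le_lift.2 hω) ?_ ?_
    · exact hL
    · exact le_rfl
  have hc2 : #(Set (M × Z) × Set Z × Set Z) ≤ 2 ^ κ := by
    simp only [mk_prod, lift_id, mk_set, hZ]
    refine mul_le_of_le h2κ (power_le_power_left two_ne_zero (mul_le_of_le hω hM le_rfl))
      (mul_le_of_le h2κ le_rfl le_rfl)
  have hc : #(Set (L.Symbols × List Z) × Set (M × Z) × Set Z × Set Z) ≤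
      Cardinal.lift.{max u v} (2 ^ κ) := by
    rw [mk_prod]
    refine mul_le_of_le (aleph0_le_lift.2 h2κ) ?_ ?_
    · rw [lift_id'.{w, max u v w}]
      exact hc1
    · rw [lift_umax.{w, max u v}]
      exact lift_le.2 hc2
  have h3 := lift_mk_le_lift_mk_of_injective hinj
  have h4 := h3.trans (lift_le.{max u v (w + 1)}.2 hc)
  rw [lift_lift] at h4
  exact (lift_id'.{max u v w, max u v (w + 1)} _).symm.trans_le h4

/-- Totally transcendental classes are stable in the cardinals `μ` with `μ ^ κ = μ`. -/
theorem stable_of_totallyTranscendental {κ : Cardinal.{w}} (hLS : K.LS ≤ κ)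
    (hL : Cardinal.lift.{w} L.card ≤ Cardinal.lift.{max u v} κ)
    (htt : K.TotallyTranscendental κ) {μ : Cardinal.{w}} (hμ : ℵ₀ ≤ μ) (hμκ : μ ^ κ = μ) :
    K.Stable μ := by
  intro M _ hM hMμ
  refine le_antisymm ?_ (hMμ ▸ lift_mk_le_mk_gaType hM)
  have hω := (isLSBound_of_le hLS).1
  have h2κ : 2 ^ κ ≤ μ :=
    (power_le_power_right (ofNat_lt_aleph0.le.trans hμ)).trans_eq hμκ
  have hκμ : κ ≤ μ := (cantor κ).le.trans h2κ
  -- The first ordinal at which `RankGE` fails for `q` is neither `0` nor a limit, hence is some `α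
  -- + 1`. A submodel `N` where it fails has `q ↾ N` of rank exactly `α`.
  have key : ∀ q : K.GaType M, ∃ (α : Ordinal.{max u v (w + 1)})
      (N : {N : L.Substructure M // K.Strong M N ∧ #N ≤ κ}),
      K.RankGE κ α q ∧ ¬ K.SmallRankGE κ (α + 1) N.1 (q.restrictTo N.1 N.2.1) := by
    intro q
    let β := sInf {β | ¬ K.RankGE κ β q}
    have hβ : ¬ K.RankGE κ β q := csInf_mem (s := {β | ¬ K.RankGE κ β q}) (htt M hM q)
    have hmin : ∀ γ < β, K.RankGE κ γ q := fun γ hγ => by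
      by_contra h
      exact notMem_of_lt_csInf' hγ h
    have hβ' := hβ
    unfold RankGE at hβ'
    push Not at hβ'
    obtain ⟨N, hN, hNκ, hNβ⟩ := hβ'
    rcases Ordinal.zero_or_succ_or_isSuccLimit β with h | ⟨α, h⟩ | h
    · rw [h] at hNβ
      exact absurd (smallRankGE_zero _) hNβ
    · rw [← h, Order.succ_eq_add_one] at hNβ
      exact ⟨α, ⟨N, hN, hNκ⟩, hmin α (h ▸ Order.lt_succ α), hNβ⟩
    · rw [smallRankGE_limit h] at hNβ
      exact absurd (fun γ hγ => hmin γ hγ N hN hNκ) hNβ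
  choose α N hα hN using key
  let Φ : K.GaType M → Σ N : {N : L.Substructure M // K.Strong M N ∧ #N ≤ κ}, K.GaType N.1 :=
    fun q => ⟨N q, q.restrictTo (N q).1 (N q).2.1⟩
  have hΦ : ∀ q y, Φ q = y → q.restrictTo y.1.1 y.1.2.1 = y.2 ∧
      K.SmallRankGE κ (α q) y.1.1 y.2 ∧ ¬ K.SmallRankGE κ (α q + 1) y.1.1 y.2 := by
    rintro q _ rfl
    exact ⟨rfl, hα q (N q).1 (N q).2.1 (N q).2.2, hN q⟩
  -- The members of a fibre extend the same type `y.2` and share its rank `α`. More than `κ` of them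
  -- would show, with `M` as the larger model, that `y.2` has rank at least `α + 1`.
  have hfib : ∀ y, #{q // Φ q = y} ≤ Cardinal.lift.{max u v (w + 1)} κ := by
    intro y
    by_contra! hlt
    obtain ⟨⟨q₀, hq₀⟩⟩ := mk_ne_zero_iff.1 (pos_of_gt hlt).ne'
    obtain ⟨-, h1, h2⟩ := hΦ q₀ y hq₀
    refine h2 (smallRankGE_add_one.2 ⟨M, inferInstance, y.1.1.subtype,
      isStrongEmb_subtype y.1.2.1, hlt.trans_le ?_⟩)
    refine mk_subtype_mono fun q hq => ?_
    obtain ⟨h3, h4, h5⟩ := hΦ q y hq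
    have hαq : α q = α q₀ := by
      rcases lt_trichotomy (α q) (α q₀) with h | h | h
      · exact absurd (h1.mono (Order.add_one_le_of_lt h)) h5
      · exact h
      · exact absurd (h4.mono (Order.add_one_le_of_lt h)) h2
    exact ⟨h3, hαq ▸ hα q⟩
  have hμ' : ℵ₀ ≤ Cardinal.lift.{max u v (w + 1)} μ := aleph0_le_lift.2 hμ
  have hsub : #{N : L.Substructure M // K.Strong M N ∧ #N ≤ κ} ≤ μ := by
    have h1 : #{N : L.Substructure M // K.Strong M N ∧ #N ≤ κ} ≤ #{t : Set M // #t ≤ κ} :=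
      mk_le_of_injective (f := fun N => ⟨(N.1 : Set M), N.2.2⟩) fun N N' h =>
        Subtype.ext (SetLike.coe_injective (congrArg Subtype.val h))
    refine h1.trans ((mk_bounded_set_le M κ).trans ?_)
    rw [hMμ, max_eq_left hμ, hμκ]
  have hcod : #(Σ N : {N : L.Substructure M // K.Strong M N ∧ #N ≤ κ}, K.GaType N.1) ≤
      Cardinal.lift.{max u v (w + 1)} μ := by
    rw [mk_sigma]
    refine (sum_le_sum _ (fun _ => Cardinal.lift.{max u v (w + 1)} μ) fun N =>
      (mk_gaType_le_two_power hLS hL N.2.2).trans (lift_le.2 h2κ)).trans ?_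
    rw [sum_const]
    refine mul_le_of_le hμ' (lift_le.2 hsub) ?_
    rw [lift_lift]
  rw [← mk_congr (Equiv.sigmaFiberEquiv Φ), mk_sigma]
  refine (sum_le_sum _ (fun _ => Cardinal.lift.{max u v (w + 1)} μ) fun y =>
    (hfib y).trans (lift_le.2 hκμ)).trans ?_
  rw [sum_const']
  exact mul_le_of_le hμ' hcod le_rfl

end Counting

end AEC

/-! ### The proposition -/

theorem proposition5p3 {L : FirstOrder.Language.{u, v}} (K : AEC.{u, v, w} L)
    (hJEP : K.JointEmbedding) (hAP : K.Amalgamation)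
    (χ : Cardinal.{w}) (hχ : K.LS ≤ χ) (htame : K.Tame χ)
    (lam : Cardinal.{w})
    (hlam : Cardinal.lift.{max u v} χ + Cardinal.lift.{w} L.card ≤ Cardinal.lift.{max u v} lam)
    (hpow : lam < lam ^ ℵ₀) (hstable : K.Stable lam) :
    (∀ μ : Cardinal.{w}, ℵ₀ ≤ μ → μ ^ lam = μ → K.Stable μ) ∧
    ∃ κ : Cardinal.{w},
      IsLeast {ν : Cardinal.{w} |
        Cardinal.lift.{max u v} χ + Cardinal.lift.{w} L.card ≤ Cardinal.lift.{max u v} ν ∧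
          K.TotallyTranscendental ν} κ ∧
      κ ≤ lam ∧
      ∀ μ : Cardinal.{w}, ℵ₀ ≤ μ → μ ^ κ = μ → K.Stable μ := by
  have hbound : ∀ ν : Cardinal.{w},
      Cardinal.lift.{max u v} χ + Cardinal.lift.{w} L.card ≤ Cardinal.lift.{max u v} ν →
        χ ≤ ν ∧ Cardinal.lift.{w} L.card ≤ Cardinal.lift.{max u v} ν := fun ν hν =>
    ⟨lift_le.1 (self_le_add_right _ _ |>.trans hν), (self_le_add_left _ _).trans hν⟩
  have htt : K.TotallyTranscendental lam :=
    AEC.totallyTranscendental_of_stable hJEP hAP htame (hbound lam hlam).1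
      (hχ.trans (hbound lam hlam).1) hpow hstable
  have hstab : ∀ ν ∈ {ν : Cardinal.{w} |
        Cardinal.lift.{max u v} χ + Cardinal.lift.{w} L.card ≤ Cardinal.lift.{max u v} ν ∧
          K.TotallyTranscendental ν}, ∀ μ : Cardinal.{w}, ℵ₀ ≤ μ → μ ^ ν = μ → K.Stable μ :=
    fun ν hν μ hμ h => AEC.stable_of_totallyTranscendental (hχ.trans (hbound ν hν.1).1)
      (hbound ν hν.1).2 hν.2 hμ h
  have hmem := csInf_mem (s := {ν : Cardinal.{w} |
        Cardinal.lift.{max u v} χ + Cardinal.lift.{w} L.card ≤ Cardinal.lift.{max u v} ν ∧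
          K.TotallyTranscendental ν}) ⟨lam, hlam, htt⟩
  exact ⟨hstab lam ⟨hlam, htt⟩, _, ⟨hmem, fun ν hν => csInf_le' hν⟩, csInf_le' ⟨hlam, htt⟩,
    hstab _ hmem⟩
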